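/- Let $k\ge 1$. A $k$-graph is a countable small category $\Lambda$ with a degree functor $d:\Lambda\to\mathbb{N}^k$ such that whenever $d(\lambda)=m+n$ there are unique morphisms $\mu,\nu$ with $\lambda=\mu\nu$, $d(\mu)=m$, $d(\nu)=n$. Morphisms are called paths, objects are called vertices (and are identified with the identity morphisms), $r(\lambda)$ and $s(\lambda)$ denote the range (codomain) and source (domain) of $\lambda$, and $\mu\nu$ is defined when $s(\mu)=r(\nu)$. $\Lambda$ is row-finite if $v\Lambda^n=\{\lambda: r(\lambda)=v,\ d(\lambda)=n\}$ is finite for every vertex $v$ and every $n\in\mathbb{N}^k$, and strongly connected if for all vertices $v,w$ there is a path with range $v$ and source $w$. Let $\Omega_k$ be the $k$-graph with objects $\mathbb{N}^k$ and exactly one morphism $(p,q)$, of range $p$, source $q$ and degree $q-p$, for each pair $p\le q$. An infinite path $x\in\Lambda^\infty$ is a degree-preserving functor $x:\Omega_k\to\Lambda$. For a row-finite $k$-graph $\Lambda$, a Cuntz--Krieger $\Lambda$-family in a $C^*$-algebra is a family $(t_\lambda)_{\lambda\in\Lambda}$ of partial isometries such that the $t_v$ ($v$ a vertex) are mutually orthogonal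 projections, $t_\lambda t_\eta=t_{\lambda\eta}$ if $s(\lambda)=r(\eta)$, $t_\lambda^*t_\lambda=t_{s(\lambda)}$, and $t_v=\sum_{\lambda\in v\Lambda^n}t_\lambda t_\lambda^*$ for every vertex $v$ and every $n\in\mathbb{N}^k$. The $C^*$-algebra $C^*(\Lambda)$ is the universal $C^*$-algebra generated by a Cuntz--Krieger $\Lambda$-family $(t_\lambda)$. Given $x\in\Lambda^\infty$, for $i\in\mathbb{N}$ put $v_i=x(i,\dots,i)$ and let $x_i=x\big((i,\dots,i),(i+1,\dots,i+1)\big)$, a path of degree $(1,\dots,1)$ with range $v_i$ and source $v_{i+1}$. Let $F_i=\Lambda v_i$ be the set of paths with source $v_i$, let $\{\xi^i_\mu:\mu\in F_i\}$ be the standard orthonormal basis of $\ell^2(F_i)$, let $\rho_i:\ell^2(F_i)\to\ell^2(F_{i+1})$ be the isometry with $\rho_i(\xi^i_\mu)=\xi^{i+1}_{\mu x_i}$, let $\mathcal{H}_x=\varinjlim(\ell^2(F_i),\rho_i)$ be the inductive limit Hilbert space, and let $[\xi^i_\mu]\in\mathcal{H}_x$ be the class of $\xi^i_\mu$. Proposition.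 Let $\Lambda$ be a row-finite, strongly connected $k$-graph and let $x\in\Lambda^\infty$. Then $\mathcal{H}_x$ is separable, and there are unique bounded operators $T_\lambda\in B(\mathcal{H}_x)$, $\lambda\in\Lambda$, such that for all $i\in\mathbb{N}$ and $\mu\in F_i$ $$T_\lambda[\xi^i_\mu]=\begin{cases}[\xi^i_{\lambda\mu}] & \text{if } s(\lambda)=r(\mu),\\ 0 & \text{otherwise.}\end{cases}$$ These operators form a Cuntz--Krieger $\Lambda$-family, and the unique $*$-homomorphism $\pi_x:C^*(\Lambda)\to B(\mathcal{H}_x)$ with $\pi_x(t_\lambda)=T_\lambda$ for all $\lambda\in\Lambda$ is injective. (No aperiodicity assumption on $\Lambda$ is made.) -/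

import Mathlib

open CategoryTheory
open scoped ComplexConjugate

universe u v

/-! ### The free `*`-algebra on a set -/

/-- The free (non-unital, associative, complex) `*`-algebra on a set `X`: finite linear combinations
of nonempty words in the letters `(x, false) = x` and `(x, true) = x*`. -/
def FreeStarAlg (X : Type u) : Type u := MonoidAlgebra ℂ (FreeSemigroup (X × Bool))

namespace FreeStarAlg

variable (X : Type u)

noncomputable instance : NonUnitalRing (FreeStarAlg X) :=
  inferInstanceAs (NonUnitalRing (MonoidAlgebra ℂ (FreeSemigroup (X × Bool))))

noncomputable instance : Module ℂ (FreeStarAlg X) :=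
  inferInstanceAs (Module ℂ (MonoidAlgebra ℂ (FreeSemigroup (X × Bool))))

instance : IsScalarTower ℂ (FreeStarAlg X) (FreeStarAlg X) :=
  inferInstanceAs (IsScalarTower ℂ (MonoidAlgebra ℂ (FreeSemigroup (X × Bool)))
    (MonoidAlgebra ℂ (FreeSemigroup (X × Bool))))

instance : SMulCommClass ℂ (FreeStarAlg X) (FreeStarAlg X) :=
  inferInstanceAs (SMulCommClass ℂ (MonoidAlgebra ℂ (FreeSemigroup (X × Bool)))
    (MonoidAlgebra ℂ (FreeSemigroup (X × Bool))))

variable {X}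

/-- The adjoint of a word: reverse it and exchange `x` and `x*` in every letter. -/
def adjWord : FreeSemigroup (X × Bool) →ₙ* (FreeSemigroup (X × Bool))ᵐᵒᵖ :=
  FreeSemigroup.lift fun p => MulOpposite.op (FreeSemigroup.of (p.1, !p.2))

theorem adjWord_adjWord (w : FreeSemigroup (X × Bool)) :
    (adjWord (adjWord w).unop).unop = w := by
  induction w with
  | ih1 p => simp [adjWord]
  | ih2 p w h1 h2 => rw [map_mul, MulOpposite.unop_mul, map_mul, MulOpposite.unop_mul, h1, h2]

/-- The monomial `c w`. -/
noncomputable def mono (w : FreeSemigroup (X × Bool)) (c : ℂ) : FreeStarAlg X :=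
  MonoidAlgebra.single w c

theorem mono_mul (w w' : FreeSemigroup (X × Bool)) (c c' : ℂ) :
    mono w c * mono w' c' = mono (w * w') (c * c') :=
  MonoidAlgebra.single_mul_single ..

theorem smul_mono (w : FreeSemigroup (X × Bool)) (c c' : ℂ) :
    c • mono w c' = mono w (c * c') :=
  MonoidAlgebra.smul_single ..

@[elab_as_elim]
theorem ind {P : FreeStarAlg X → Prop} (a : FreeStarAlg X)
    (hm : ∀ w c, P (mono w c)) (h0 : P 0) (ha : ∀ a b, P a → P b → P (a + b)) : P a := by
  obtain ⟨f⟩ := a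
  induction f using Finsupp.induction_linear with
  | zero => exact h0
  | add f g hf hg => exact ha _ _ hf hg
  | single w c => exact hm w c

/-- The adjoint `(∑ c_w w)* = ∑ conj(c_w) w*`, on the semigroup algebra. -/
noncomputable def adjAux : MonoidAlgebra ℂ (FreeSemigroup (X × Bool)) →+
    MonoidAlgebra ℂ (FreeSemigroup (X × Bool)) :=
  (Finsupp.liftAddHom fun w : FreeSemigroup (X × Bool) =>
    (MonoidAlgebra.singleAddHom (R := ℂ) (adjWord w).unop).comp
      (starRingEnd ℂ).toAddMonoidHom).comp
    (MonoidAlgebra.coeffAddEquiv (R := ℂ) (M := FreeSemigroup (X × Bool))).toAddMonoidHom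

theorem adjAux_single (w : FreeSemigroup (X × Bool)) (c : ℂ) :
    adjAux (MonoidAlgebra.single w c) = MonoidAlgebra.single (adjWord w).unop (conj c) := by
  simp [adjAux]

/-- The adjoint on the free `*`-algebra. -/
noncomputable def adj : FreeStarAlg X →+ FreeStarAlg X := adjAux

theorem adj_mono (w : FreeSemigroup (X × Bool)) (c : ℂ) :
    adj (mono w c) = mono (adjWord w).unop (conj c) := adjAux_single w c

noncomputable instance : StarRing (FreeStarAlg X) where
  star := adj
  star_involutive a := by
    induction a using ind with
    | hm w c => simp [adj_mono, adjWord_adjWord]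
    | h0 => simp
    | ha a b h1 h2 => rw [map_add, map_add, h1, h2]
  star_add := map_add adj
  star_mul a b := by
    induction a using ind with
    | hm w c =>
      induction b using ind with
      | hm w' c' => simp only [mono_mul, adj_mono, map_mul, MulOpposite.unop_mul, mul_comm]
      | h0 => simp
      | ha a b h1 h2 => rw [mul_add, map_add, map_add, add_mul, h1, h2]
    | h0 => simp
    | ha a b h1 h2 => rw [add_mul, map_add, map_add, mul_add, h1, h2]

theorem star_mono (w : FreeSemigroup (X × Bool)) (c : ℂ) :
    star (mono w c) = mono (adjWord w).unop (conj c) := adj_mono w c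

instance : StarModule ℂ (FreeStarAlg X) where
  star_smul c a := by
    induction a using ind with
    | hm w c' => simp [smul_mono, star_mono]
    | h0 => simp
    | ha a b h1 h2 => rw [smul_add, star_add, star_add, h1, h2, smul_add]

/-- The generator of the free `*`-algebra attached to `x`. -/
noncomputable def gen (x : X) : FreeStarAlg X := mono (FreeSemigroup.of (x, false)) 1

theorem star_gen (x : X) : star (gen x) = mono (FreeSemigroup.of (x, true)) 1 := by
  simp [gen, star_mono, adjWord]

theorem mono_of_true (x : X) : mono (FreeSemigroup.of (x, true)) 1 = star (gen x) :=
  (star_gen x).symm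

theorem hom_ext {A : Type*} [NonUnitalRing A] [StarRing A] [Module ℂ A]
    {φ ψ : FreeStarAlg X →⋆ₙₐ[ℂ] A} (h : ∀ x, φ (gen x) = ψ (gen x)) : φ = ψ := by
  have hof : ∀ p : X × Bool, φ (mono (FreeSemigroup.of p) 1) = ψ (mono (FreeSemigroup.of p) 1) := by
    rintro ⟨x, _ | _⟩
    · exact h x
    · rw [mono_of_true, map_star, map_star, h]
  have hw : ∀ w : FreeSemigroup (X × Bool), φ (mono w 1) = ψ (mono w 1) := fun w => by
    induction w with
    | ih1 p => exact hof p
    | ih2 p w _ hw =>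
      have : mono (FreeSemigroup.of p * w) 1 = mono (FreeSemigroup.of p) 1 * mono w 1 := by
        rw [mono_mul, one_mul]
      rw [this, map_mul, map_mul, hof, hw]
  ext a
  induction a using ind with
  | hm w c =>
    have : mono w c = c • mono w 1 := by rw [smul_mono, mul_one]
    rw [this, map_smul, map_smul, hw]
  | h0 => rw [map_zero, map_zero]
  | ha a b h1 h2 => rw [map_add, map_add, h1, h2]

theorem exists_lift {A : Type*} [NonUnitalRing A] [StarRing A] [Module ℂ A] [IsScalarTower ℂ A A]
    [SMulCommClass ℂ A A] [StarModule ℂ A] (s : X → A) :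
    ∃ φ : FreeStarAlg X →⋆ₙₐ[ℂ] A, ∀ x, φ (gen x) = s x := by
  let σ : FreeSemigroup (X × Bool) →ₙ* A :=
    FreeSemigroup.lift fun p => if p.2 then star (s p.1) else s p.1
  have hσ : ∀ w, σ (adjWord w).unop = star (σ w) := fun w => by
    induction w with
    | ih1 p => rcases p with ⟨x, _ | _⟩ <;> simp [σ, adjWord]
    | ih2 p w h1 h2 => rw [map_mul, MulOpposite.unop_mul, map_mul, map_mul, h1, h2, star_mul]
  let φ₀ : MonoidAlgebra ℂ (FreeSemigroup (X × Bool)) →ₙₐ[ℂ] A := MonoidAlgebra.liftMagma ℂ σ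
  let φ : FreeStarAlg X →ₙₐ[ℂ] A := φ₀
  have hφ : ∀ w c, φ (mono w c) = c • σ w := fun w c => by
    change φ₀ (MonoidAlgebra.single w c) = _
    simp [φ₀]
  refine ⟨{ φ with map_star' := fun a => ?_ }, fun x => ?_⟩
  · change φ (star a) = star (φ a)
    induction a using ind with
    | hm w c => rw [star_mono, hφ, hφ, hσ, star_smul]; rfl
    | h0 => rw [star_zero, map_zero, star_zero]
    | ha a b h1 h2 => rw [star_add, map_add, map_add, star_add, h1, h2]
  · change φ (mono _ 1) = s x
    rw [hφ, one_smul]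
    simp [σ]

end FreeStarAlg

/-! ### `C*`-seminorms and the `C*`-algebra obtained from one by separation and completion -/

section CStarSeminorm

variable (F : Type u) [NonUnitalRing F] [StarRing F] [Module ℂ F]

/-- A `C*`-seminorm on a complex `*`-algebra. -/
structure CStarSeminorm extends Seminorm ℂ F where
  mul_le' : ∀ a b, toFun (a * b) ≤ toFun a * toFun b
  star_mul_self' : ∀ a, toFun (star a * a) = toFun a ^ 2

variable {F}

namespace CStarSeminorm

instance : FunLike (CStarSeminorm F) F ℝ where
  coe N := N.toFun
  coe_injective := by
    rintro ⟨p, _, _⟩ ⟨q, _, _⟩ h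
    have : p = q := DFunLike.coe_injective h
    subst this; rfl

instance : SeminormClass (CStarSeminorm F) ℂ F where
  map_zero N := map_zero N.toSeminorm
  map_add_le_add N := map_add_le_add N.toSeminorm
  map_neg_eq_map N := map_neg_eq_map N.toSeminorm
  map_smul_eq_mul N := map_smul_eq_mul N.toSeminorm

theorem mul_le (N : CStarSeminorm F) (a b : F) : N (a * b) ≤ N a * N b := N.mul_le' a b

theorem star_mul_self (N : CStarSeminorm F) (a : F) : N (star a * a) = N a ^ 2 :=
  N.star_mul_self' a

theorem star_eq (N : CStarSeminorm F) (a : F) : N (star a) = N a := by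
  have key : ∀ b, N b ≤ N (star b) := fun b => by
    have h := (N.star_mul_self b).symm.le.trans (N.mul_le _ _)
    rcases (apply_nonneg N b).eq_or_lt with h0 | h0
    · rw [← h0]; exact apply_nonneg N _
    · rw [sq] at h; exact le_of_mul_le_mul_right h h0
  exact le_antisymm (by simpa using key (star a)) (key a)

/-- The zero seminorm. -/
noncomputable def zero : CStarSeminorm F := { (0 : Seminorm ℂ F) with
  mul_le' := fun a b => by
    show (0 : ℝ) ≤ 0 * 0
    simp
  star_mul_self' := fun a => by
    show (0 : ℝ) = 0 ^ 2
    simp }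

/-- The pointwise supremum of a nonempty, pointwise bounded set of `C*`-seminorms. -/
noncomputable def sup (S : Set (CStarSeminorm F)) (hne : S.Nonempty)
    (hbd : ∀ a, BddAbove (Set.range fun N : S => N.1 a)) : CStarSeminorm F :=
  haveI : Nonempty S := hne.to_subtype
  { toFun := fun a => ⨆ N : S, N.1 a
    map_zero' := by simp
    add_le' := fun a b => ciSup_le fun N => (map_add_le_add N.1 a b).trans
      (add_le_add (le_ciSup (hbd a) N) (le_ciSup (hbd b) N))
    neg' := fun a => by simp
    smul' := fun c a => by
      simp only [map_smul_eq_mul]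
      exact (Real.mul_iSup_of_nonneg (norm_nonneg c) _).symm
    mul_le' := fun a b => ciSup_le fun N => (N.1.mul_le a b).trans
      (mul_le_mul (le_ciSup (hbd a) N) (le_ciSup (hbd b) N) (apply_nonneg _ _)
        ((apply_nonneg N.1 a).trans (le_ciSup (hbd a) N)))
    star_mul_self' := fun a => by
      simp only [star_mul_self]
      refine le_antisymm (ciSup_le fun N => ?_) ?_
      · exact pow_le_pow_left₀ (apply_nonneg _ _) (le_ciSup (hbd a) N) 2
      · have hb : BddAbove (Set.range fun N : S => N.1 a ^ 2) := by
          obtain ⟨M, hM⟩ := hbd a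
          refine ⟨M ^ 2, ?_⟩
          rintro _ ⟨N, rfl⟩
          exact pow_le_pow_left₀ (apply_nonneg _ _) (hM ⟨N, rfl⟩) 2
        have h0 : 0 ≤ ⨆ N : S, N.1 a ^ 2 := Real.iSup_nonneg fun N => by positivity
        have h1 : (⨆ N : S, N.1 a) ≤ √(⨆ N : S, N.1 a ^ 2) :=
          ciSup_le fun N => Real.le_sqrt_of_sq_le (le_ciSup hb N)
        calc (⨆ N : S, N.1 a) ^ 2 ≤ √(⨆ N : S, N.1 a ^ 2) ^ 2 :=
              pow_le_pow_left₀ (Real.iSup_nonneg fun N => apply_nonneg _ _) h1 2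
          _ = ⨆ N : S, N.1 a ^ 2 := Real.sq_sqrt h0 }

theorem le_sup {S : Set (CStarSeminorm F)} (hne : S.Nonempty)
    (hbd : ∀ a, BddAbove (Set.range fun N : S => N.1 a)) {N : CStarSeminorm F} (hN : N ∈ S)
    (a : F) : N a ≤ sup S hne hbd a :=
  le_ciSup (hbd a) ⟨N, hN⟩

theorem dist_aux (N : CStarSeminorm F) : (∀ a, N (-a + a) = 0) ∧
    (∀ a b, N (-a + b) = N (-b + a)) ∧ ∀ a b c, N (-a + c) ≤ N (-a + b) + N (-b + c) := by
  refine ⟨fun a => by simp, fun a b => ?_, fun a b c => ?_⟩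
  · rw [← map_neg_eq_map N (-a + b)]; simp
  · have h : -a + c = (-a + b) + (-b + c) := by abel
    rw [h]; exact map_add_le_add N _ _

/-- The `C*`-seminorm `a ↦ ‖φ a‖` defined by a `*`-homomorphism into a `C*`-algebra. -/
noncomputable def comap {A : Type*} [NonUnitalCStarAlgebra A] (φ : F →⋆ₙₐ[ℂ] A) :
    CStarSeminorm F where
  toFun a := ‖φ a‖
  map_zero' := by simp
  add_le' a b := by rw [map_add]; exact norm_add_le _ _
  neg' a := by simp
  smul' c a := by rw [map_smul, norm_smul]
  mul_le' a b := by rw [map_mul]; exact norm_mul_le _ _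
  star_mul_self' a := by rw [map_mul, map_star, CStarRing.norm_star_mul_self, sq]

/-- The `*`-algebra `F`, regarded as a seminormed `*`-algebra by means of `N`. -/
def Pre (_N : CStarSeminorm F) : Type u := F

section Pre

variable (N : CStarSeminorm F)

noncomputable instance : NonUnitalRing N.Pre := inferInstanceAs (NonUnitalRing F)

noncomputable instance : NonUnitalSeminormedRing N.Pre where
  __ := (inferInstance : NonUnitalRing N.Pre)
  norm := (N : F → ℝ)
  dist := fun a b : F => N (-a + b)
  dist_self := N.dist_aux.1
  dist_comm := N.dist_aux.2.1
  dist_triangle := N.dist_aux.2.2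
  dist_eq _ _ := rfl
  norm_mul_le := N.mul_le

theorem norm_pre (a : N.Pre) : ‖a‖ = N (show F from a) := rfl

noncomputable instance : StarRing N.Pre := inferInstanceAs (StarRing F)
noncomputable instance : Module ℂ N.Pre := inferInstanceAs (Module ℂ F)
instance [IsScalarTower ℂ F F] : IsScalarTower ℂ N.Pre N.Pre :=
  inferInstanceAs (IsScalarTower ℂ F F)
instance [SMulCommClass ℂ F F] : SMulCommClass ℂ N.Pre N.Pre :=
  inferInstanceAs (SMulCommClass ℂ F F)
instance [StarModule ℂ F] : StarModule ℂ N.Pre :=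
  inferInstanceAs (StarModule ℂ F)

noncomputable instance : NormedSpace ℂ N.Pre where
  __ := (inferInstance : Module ℂ N.Pre)
  norm_smul_le c a := (map_smul_eq_mul N c (show F from a)).le

instance : NormedStarGroup N.Pre where
  norm_star_le a := (N.star_eq (show F from a)).le

/-- The separated completion of `F` with respect to the `C*`-seminorm `N`. -/
def Envelope : Type u := UniformSpace.Completion N.Pre

namespace Envelope

noncomputable instance : NormedAddCommGroup N.Envelope :=
  inferInstanceAs (NormedAddCommGroup (UniformSpace.Completion N.Pre))
noncomputable instance : NormedSpace ℂ N.Envelope :=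
  inferInstanceAs (NormedSpace ℂ (UniformSpace.Completion N.Pre))
instance : CompleteSpace N.Envelope :=
  inferInstanceAs (CompleteSpace (UniformSpace.Completion N.Pre))

variable {N}

/-- The canonical map of `F` into its completion. -/
noncomputable def ι (a : F) : N.Envelope := UniformSpace.Completion.coe' (α := N.Pre) a

theorem ι_add (a b : F) : (ι (a + b) : N.Envelope) = ι a + ι b :=
  UniformSpace.Completion.coe_add (α := N.Pre) a b
theorem ι_smul (c : ℂ) (a : F) : (ι (c • a) : N.Envelope) = c • ι a :=
  UniformSpace.Completion.coe_smul (X := N.Pre) c a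
theorem ι_zero : (ι 0 : N.Envelope) = 0 := UniformSpace.Completion.coe_zero (α := N.Pre)
theorem norm_ι (a : F) : ‖(ι a : N.Envelope)‖ = N a := UniformSpace.Completion.norm_coe (E := N.Pre) a
theorem denseRange_ι : DenseRange (ι : F → N.Envelope) :=
  UniformSpace.Completion.denseRange_coe (α := N.Pre)

@[elab_as_elim]
theorem ind {P : N.Envelope → Prop} (a : N.Envelope) (hc : IsClosed {a | P a})
    (h : ∀ a : F, P (ι a)) : P a :=
  UniformSpace.Completion.induction_on (α := N.Pre) a hc h

noncomputable instance : Mul N.Envelope where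
  mul a b := (UniformSpace.Completion.isDenseInducing_coe (α := N.Pre)).prodMap
    (UniformSpace.Completion.isDenseInducing_coe (α := N.Pre)) |>.extend
    (fun p : N.Pre × N.Pre => (ι (p.1 * p.2 : N.Pre) : N.Envelope)) (a, b)

theorem ι_mul (a b : F) : (ι (a * b) : N.Envelope) = ι a * ι b :=
  ((UniformSpace.Completion.isDenseInducing_coe (α := N.Pre)).prodMap
    (UniformSpace.Completion.isDenseInducing_coe (α := N.Pre)) |>.extend_eq
      ((UniformSpace.Completion.continuous_coe N.Pre).comp
        (continuous_mul (M := N.Pre))) (a, b)).symm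

instance : ContinuousMul N.Envelope where
  continuous_mul := by
    let m := (AddMonoidHom.mul : N.Pre →+ N.Pre →+ N.Pre).compr₂ UniformSpace.Completion.toCompl
    have : Continuous fun p : N.Pre × N.Pre => m p.1 p.2 :=
      (UniformSpace.Completion.continuous_coe N.Pre).comp (continuous_mul (M := N.Pre))
    have di : IsDenseInducing (UniformSpace.Completion.toCompl : N.Pre → UniformSpace.Completion N.Pre) :=
      UniformSpace.Completion.isDenseInducing_coe
    exact (di.extend_Z_bilin di this :)

noncomputable instance : Star N.Envelope where
  star := UniformSpace.Completion.map (star : N.Pre → N.Pre)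

theorem ι_star (a : F) : (ι (star a) : N.Envelope) = star (ι a) :=
  (UniformSpace.Completion.map_coe (α := N.Pre) (β := N.Pre)
    (star_isometry (E := N.Pre)).uniformContinuous a).symm

theorem continuous_star' : Continuous (star : N.Envelope → N.Envelope) :=
  UniformSpace.Completion.continuous_map (α := N.Pre) (β := N.Pre)

theorem ext₁ {f g : N.Envelope → N.Envelope} (hf : Continuous f) (hg : Continuous g)
    (h : ∀ a : F, f (ι a) = g (ι a)) (a : N.Envelope) : f a = g a :=
  ind a (isClosed_eq hf hg) h

theorem add_mul_aux (a b c : N.Envelope) : (a + b) * c = a * c + b * c := by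
  refine ext₁ (f := fun a => (a + b) * c) (g := fun a => a * c + b * c)
    (by fun_prop) (by fun_prop) (fun a => ?_) a
  refine ext₁ (f := fun b => (ι a + b) * c) (g := fun b => ι a * c + b * c)
    (by fun_prop) (by fun_prop) (fun b => ?_) b
  refine ext₁ (f := fun c => (ι a + ι b) * c) (g := fun c => ι a * c + ι b * c)
    (by fun_prop) (by fun_prop) (fun c => ?_) c
  simp only [← ι_add, ← ι_mul, add_mul]

theorem mul_add_aux (a b c : N.Envelope) : a * (b + c) = a * b + a * c := by
  refine ext₁ (f := fun a => a * (b + c)) (g := fun a => a * b + a * c)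
    (by fun_prop) (by fun_prop) (fun a => ?_) a
  refine ext₁ (f := fun b => ι a * (b + c)) (g := fun b => ι a * b + ι a * c)
    (by fun_prop) (by fun_prop) (fun b => ?_) b
  refine ext₁ (f := fun c => ι a * (ι b + c)) (g := fun c => ι a * ι b + ι a * c)
    (by fun_prop) (by fun_prop) (fun c => ?_) c
  simp only [← ι_add, ← ι_mul, mul_add]

theorem mul_assoc_aux (a b c : N.Envelope) : (a * b) * c = a * (b * c) := by
  refine ext₁ (f := fun a => (a * b) * c) (g := fun a => a * (b * c))
    ((continuous_id.mul continuous_const).mul continuous_const)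
    (continuous_id.mul continuous_const) (fun a => ?_) a
  refine ext₁ (f := fun b => (ι a * b) * c) (g := fun b => ι a * (b * c))
    ((continuous_const.mul continuous_id).mul continuous_const)
    (continuous_const.mul (continuous_id.mul continuous_const)) (fun b => ?_) b
  refine ext₁ (f := fun c => (ι a * ι b) * c) (g := fun c => ι a * (ι b * c))
    (continuous_const.mul continuous_id)
    (continuous_const.mul (continuous_const.mul continuous_id)) (fun c => ?_) c
  simp only [← ι_mul, mul_assoc]

theorem zero_mul_aux (a : N.Envelope) : 0 * a = 0 := by
  refine ext₁ (f := fun a => 0 * a) (g := fun _ => 0) (continuous_const.mul continuous_id) continuous_const (fun a => ?_) a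
  simp only [← ι_zero, ← ι_mul, zero_mul]

theorem mul_zero_aux (a : N.Envelope) : a * 0 = 0 := by
  refine ext₁ (f := fun a => a * 0) (g := fun _ => 0) (continuous_id.mul continuous_const) continuous_const (fun a => ?_) a
  simp only [← ι_zero, ← ι_mul, mul_zero]

theorem norm_mul_le_aux (a b : N.Envelope) : ‖a * b‖ ≤ ‖a‖ * ‖b‖ := by
  refine ind (P := fun a => ‖a * b‖ ≤ ‖a‖ * ‖b‖) a
    (isClosed_le (by fun_prop) (by fun_prop)) (fun a => ?_)
  refine ind (P := fun b => ‖ι a * b‖ ≤ ‖ι a‖ * ‖b‖) b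
    (isClosed_le (by fun_prop) (by fun_prop)) (fun b => ?_)
  simp only [← ι_mul, norm_ι]
  exact N.mul_le a b

theorem star_star_aux (a : N.Envelope) : star (star a) = a :=
  ext₁ (f := fun a => star (star a)) (g := fun a => a) (continuous_star'.comp continuous_star')
    continuous_id (fun a => by simp only [← ι_star, star_star]) a

theorem star_mul_aux (a b : N.Envelope) : star (a * b) = star b * star a := by
  refine ext₁ (f := fun a => star (a * b)) (g := fun a => star b * star a)
    (continuous_star'.comp (by fun_prop)) (continuous_const.mul continuous_star') (fun a => ?_) a
  refine ext₁ (f := fun b => star (ι a * b)) (g := fun b => star b * star (ι a))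
    (continuous_star'.comp (by fun_prop)) (continuous_star'.mul continuous_const) (fun b => ?_) b
  simp only [← ι_star, ← ι_mul, star_mul]

theorem star_add_aux (a b : N.Envelope) : star (a + b) = star a + star b := by
  refine ext₁ (f := fun a => star (a + b)) (g := fun a => star a + star b)
    (continuous_star'.comp (by fun_prop)) (continuous_star'.add continuous_const) (fun a => ?_) a
  refine ext₁ (f := fun b => star (ι a + b)) (g := fun b => star (ι a) + star b)
    (continuous_star'.comp (by fun_prop)) (continuous_const.add continuous_star') (fun b => ?_) b
  simp only [← ι_star, ← ι_add, star_add]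

theorem norm_star_mul_self_aux (a : N.Envelope) : ‖a‖ * ‖a‖ ≤ ‖star a * a‖ := by
  refine ind (P := fun a => ‖a‖ * ‖a‖ ≤ ‖star a * a‖) a (isClosed_le (by fun_prop)
    (continuous_norm.comp (continuous_star'.mul continuous_id))) (fun a => ?_)
  simp only [← ι_star, ← ι_mul, norm_ι, star_mul_self, sq, le_refl]

theorem smul_mul_aux [IsScalarTower ℂ F F] (c : ℂ) (a b : N.Envelope) :
    (c • a) * b = c • (a * b) := by
  refine ext₁ (f := fun a => (c • a) * b) (g := fun a => c • (a * b))
    ((continuous_id.const_smul c).mul continuous_const)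
    ((continuous_id.mul continuous_const).const_smul c) (fun a => ?_) a
  refine ext₁ (f := fun b => (c • ι a) * b) (g := fun b => c • (ι a * b))
    (continuous_const.mul continuous_id) ((continuous_const.mul continuous_id).const_smul c) (fun b => ?_) b
  simp only [← ι_smul, ← ι_mul, smul_mul_assoc]

theorem mul_smul_aux [SMulCommClass ℂ F F] (c : ℂ) (a b : N.Envelope) :
    c • (a * b) = a * (c • b) := by
  refine ext₁ (f := fun a => c • (a * b)) (g := fun a => a * (c • b))
    ((continuous_id.mul continuous_const).const_smul c) (continuous_id.mul continuous_const) (fun a => ?_) a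
  refine ext₁ (f := fun b => c • (ι a * b)) (g := fun b => ι a * (c • b))
    ((continuous_const.mul continuous_id).const_smul c)
    (continuous_const.mul (continuous_id.const_smul c)) (fun b => ?_) b
  simp only [← ι_smul, ← ι_mul, mul_smul_comm]

theorem star_smul_aux [StarModule ℂ F] (c : ℂ) (a : N.Envelope) :
    star (c • a) = star c • star a :=
  ext₁ (f := fun a => star (c • a)) (g := fun a => star c • star a)
    (continuous_star'.comp (continuous_id.const_smul c)) ((continuous_const_smul (star c)).comp continuous_star')
    (fun a => by simp only [← ι_star, ← ι_smul, star_smul]) a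

noncomputable instance : NonUnitalNormedRing N.Envelope where
  __ := (inferInstance : NormedAddCommGroup N.Envelope)
  __ := (inferInstance : Mul N.Envelope)
  left_distrib := mul_add_aux
  right_distrib := add_mul_aux
  zero_mul := zero_mul_aux
  mul_zero := mul_zero_aux
  mul_assoc := mul_assoc_aux
  norm_mul_le := norm_mul_le_aux

noncomputable instance : StarRing N.Envelope where
  star_involutive := star_star_aux
  star_mul := star_mul_aux
  star_add := star_add_aux

noncomputable instance [IsScalarTower ℂ F F] [SMulCommClass ℂ F F] [StarModule ℂ F] :
    NonUnitalCStarAlgebra N.Envelope where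
  __ := (inferInstance : NonUnitalNormedRing N.Envelope)
  __ := (inferInstance : StarRing N.Envelope)
  __ := (inferInstance : CompleteSpace N.Envelope)
  __ := (inferInstance : NormedSpace ℂ N.Envelope)
  norm_mul_self_le := norm_star_mul_self_aux
  smul_assoc := smul_mul_aux
  smul_comm := mul_smul_aux
  star_smul := star_smul_aux

variable (N) in
/-- The canonical map of `F` into its completion, as a `*`-homomorphism. -/
noncomputable def ιHom : F →⋆ₙₐ[ℂ] N.Envelope where
  toFun := ι
  map_smul' := ι_smul
  map_zero' := ι_zero
  map_add' := ι_add
  map_mul' := ι_mul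
  map_star' := ι_star

theorem existsUnique_lift [IsScalarTower ℂ F F] [SMulCommClass ℂ F F] [StarModule ℂ F]
    {A : Type*} [NonUnitalCStarAlgebra A] (φ : F →⋆ₙₐ[ℂ] A) (hφ : ∀ a, ‖φ a‖ ≤ N a) :
    ∃! π : N.Envelope →⋆ₙₐ[ℂ] A, ∀ a, π (ι a) = φ a := by
  let φ' : N.Pre →+ A := { toFun := φ, map_zero' := map_zero φ, map_add' := map_add φ }
  have hcont : UniformContinuous φ' := by
    refine uniformContinuous_addMonoidHom_of_continuous
      (AddMonoidHomClass.continuous_of_bound φ' 1 fun a => ?_)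
    rw [one_mul]
    exact hφ a
  let g : N.Envelope → A := UniformSpace.Completion.extension φ'
  have hg : Continuous g := UniformSpace.Completion.continuous_extension
  have hgι : ∀ a, g (ι a) = φ a := fun a => UniformSpace.Completion.extension_coe hcont a
  refine ⟨{ toFun := g, map_smul' := ?_, map_zero' := ?_, map_add' := ?_, map_mul' := ?_,
            map_star' := ?_ }, hgι, ?_⟩
  · intro c a
    refine ind (P := fun a => g (c • a) = c • g a) a
      (isClosed_eq (hg.comp (continuous_const_smul c)) (hg.const_smul c)) fun a => ?_
    rw [← ι_smul, hgι, hgι, map_smul]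
  · change g 0 = 0
    rw [← ι_zero, hgι, map_zero]
  · intro a b
    change g (a + b) = g a + g b
    refine ind (P := fun a => g (a + b) = g a + g b) a
      (isClosed_eq (hg.comp (continuous_id.add continuous_const)) (hg.add continuous_const))
      fun a => ?_
    refine ind (P := fun b => g (ι a + b) = g (ι a) + g b) b
      (isClosed_eq (hg.comp (continuous_const.add continuous_id)) (continuous_const.add hg))
      fun b => ?_
    rw [← ι_add, hgι, hgι, hgι, map_add]
  · intro a b
    change g (a * b) = g a * g b
    refine ind (P := fun a => g (a * b) = g a * g b) a
      (isClosed_eq (hg.comp (continuous_id.mul continuous_const)) (hg.mul continuous_const))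
      fun a => ?_
    refine ind (P := fun b => g (ι a * b) = g (ι a) * g b) b
      (isClosed_eq (hg.comp (continuous_const.mul continuous_id)) (continuous_const.mul hg))
      fun b => ?_
    rw [← ι_mul, hgι, hgι, hgι, map_mul]
  · intro a

    refine ind (P := fun a => g (star a) = star (g a)) a
      (isClosed_eq (hg.comp continuous_star') (continuous_star.comp hg)) fun a => ?_
    rw [← ι_star, hgι, hgι, map_star]
  · intro π h
    have hπ : Continuous π :=
      AddMonoidHomClass.continuous_of_bound π 1 fun a => by
        rw [one_mul]; exact NonUnitalStarAlgHom.norm_apply_le π a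
    ext a
    change π a = g a
    refine ind (P := fun a => π a = g a) a (isClosed_eq hπ hg) fun a => ?_
    rw [h, hgι]

end Envelope
end Pre

end CStarSeminorm
end CStarSeminorm

/-! ### Higher-rank graphs -/

/-- A `k`-graph: a countable small category `Λ` with a degree functor to `ℕ^k` (coordinatewise
addition) satisfying the factorization property. A path `l` with source `a` and range `b` is a
morphism `l : a ⟶ b`, so the product `μν` of paths (first `ν`, then `μ`) is `ν ≫ μ`, and the vertices
are the objects. -/
class KGraph (k : outParam ℕ) (Λ : Type u) [Category.{v} Λ] extends CountableCategory Λ where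
  deg : ∀ {a b : Λ}, (a ⟶ b) → (Fin k → ℕ)
  deg_id : ∀ a : Λ, deg (𝟙 a) = 0
  deg_comp : ∀ {a b c : Λ} (ν : a ⟶ b) (μ : b ⟶ c), deg (ν ≫ μ) = deg μ + deg ν
  factorization : ∀ {a c : Λ} (l : a ⟶ c) (m n : Fin k → ℕ), deg l = m + n →
    ∃! p : (Σ b : Λ, (a ⟶ b) × (b ⟶ c)),
      deg p.2.2 = m ∧ deg p.2.1 = n ∧ p.2.1 ≫ p.2.2 = l

namespace KGraph

/-- The set `vΛ^n` of paths with range `v` and degree `n`. -/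
def pathsInto {k : ℕ} {Λ : Type u} [Category.{v} Λ] [KGraph k Λ] (w : Λ) (n : Fin k → ℕ) :
    Set (Σ a : Λ, a ⟶ w) :=
  {p | deg p.2 = n}

/-- `Λ` is row-finite: all the sets `vΛ^n` are finite. -/
class RowFinite {k : ℕ} (Λ : Type u) [Category.{v} Λ] [KGraph k Λ] : Prop where
  finite_pathsInto : ∀ (w : Λ) (n : Fin k → ℕ), (pathsInto w n).Finite

/-- `Λ` is strongly connected: `vΛw` is nonempty for all vertices `v`, `w`. -/
def StronglyConnected (Λ : Type u) [Category.{v} Λ] : Prop :=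
  ∀ b a : Λ, Nonempty (a ⟶ b)

/-- The objects of the `k`-graph `Ω_k`, i.e. the points of `ℕ^k`. -/
structure Omega (k : ℕ) where
  pt : Fin k → ℕ

/-- `Ω_k` has exactly one morphism, with source `q` and range `p`, for each pair `p ≤ q`. -/
instance (k : ℕ) : Category.{0} (Omega k) where
  Hom q p := PLift (p.pt ≤ q.pt)
  id _ := ⟨le_rfl⟩
  comp f g := ⟨g.down.trans f.down⟩

/-- The degree of the morphism `(p, q)` of `Ω_k` is `q - p`. -/
instance (k : ℕ) : KGraph k (Omega k) where
  countableObj :=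
    Function.Injective.countable (f := Omega.pt) (by rintro ⟨_⟩ ⟨_⟩ h; exact congrArg _ h)
  countableHom _ _ := inferInstanceAs (Countable (PLift _))
  deg {q p} _ := q.pt - p.pt
  deg_id q := funext fun _ => Nat.sub_self _
  deg_comp {a b c} f g := funext fun i => by
    have h1 : b.pt i ≤ a.pt i := f.down i
    have h2 : c.pt i ≤ b.pt i := g.down i
    simp only [Pi.sub_apply, Pi.add_apply]
    omega
  factorization {a c} l m n h := by
    have hl : c.pt ≤ a.pt := l.down
    refine ⟨⟨⟨c.pt + m⟩, ⟨fun i => ?_⟩, ⟨fun i => ?_⟩⟩, ⟨?_, ?_, rfl⟩, ?_⟩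
    · have h2 : c.pt i ≤ a.pt i := hl i
      have h1 : a.pt i - c.pt i = m i + n i := congrFun h i
      change c.pt i + m i ≤ a.pt i
      omega
    · simp
    · funext i
      change c.pt i + m i - c.pt i = m i
      omega
    · funext i
      have h2 : c.pt i ≤ a.pt i := hl i
      have h1 : a.pt i - c.pt i = m i + n i := congrFun h i
      change a.pt i - (c.pt i + m i) = n i
      omega
    · rintro ⟨⟨b⟩, ⟨f⟩, ⟨g⟩⟩ ⟨h1, -, -⟩
      have : b = c.pt + m := by
        funext i
        have h3 : b i - c.pt i = m i := congrFun h1 i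
        have h4 : c.pt i ≤ b i := g i
        change b i = c.pt i + m i
        omega
      subst this
      rfl

/-- An infinite path: a degree-preserving functor `x : Ω_k → Λ`. -/
structure InfinitePath {k : ℕ} (Λ : Type u) [Category.{v} Λ] [KGraph k Λ] where
  toFunctor : Omega k ⥤ Λ
  deg_map : ∀ {q p : Omega k} (f : q ⟶ p), deg (toFunctor.map f) = deg f

/-! ### Cuntz-Krieger families and `C*(Λ)` -/

section CK

variable {k : ℕ} {Λ : Type u} [Category.{v} Λ] [KGraph k Λ] [RowFinite Λ]

/-- The Cuntz-Krieger relations for a family `t` indexed by the paths of `Λ`: `CKRel t x y` says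
that `x = y` is one of the relations. -/
inductive CKRel {A : Type*} [NonUnitalRing A] [StarRing A] (t : ∀ ⦃a b : Λ⦄, (a ⟶ b) → A) :
    A → A → Prop
  | partial_isometry {a b : Λ} (l : a ⟶ b) : CKRel t (t l * star (t l) * t l) (t l)
  | vertex_star (w : Λ) : CKRel t (star (t (𝟙 w))) (t (𝟙 w))
  | vertex_idem (w : Λ) : CKRel t (t (𝟙 w) * t (𝟙 w)) (t (𝟙 w))
  | vertex_orth {w w' : Λ} (h : w ≠ w') : CKRel t (t (𝟙 w) * t (𝟙 w')) 0
  | mul {a b c : Λ} (ν : a ⟶ b) (μ : b ⟶ c) : CKRel t (t μ * t ν) (t (ν ≫ μ))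
  | star_mul {a b : Λ} (l : a ⟶ b) : CKRel t (star (t l) * t l) (t (𝟙 a))
  | sum (w : Λ) (n : Fin k → ℕ) : CKRel t (t (𝟙 w))
      (∑ p ∈ (RowFinite.finite_pathsInto w n).toFinset, t p.2 * star (t p.2))

/-- `t` is a Cuntz-Krieger `Λ`-family. -/
def IsCuntzKriegerFamily {A : Type*} [NonUnitalRing A] [StarRing A]
    (t : ∀ ⦃a b : Λ⦄, (a ⟶ b) → A) : Prop :=
  ∀ x y : A, CKRel t x y → x = y

variable (Λ)

/-- The set of all paths of `Λ`. -/
abbrev Path : Type (max u v) := Σ a b : Λ, (a ⟶ b)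

variable {Λ} in
/-- The generator of the free `*`-algebra attached to a path. -/
noncomputable def freeGen ⦃a b : Λ⦄ (l : a ⟶ b) : FreeStarAlg (Path Λ) :=
  FreeStarAlg.gen ⟨a, b, l⟩

/-- The `C*`-seminorms on the free `*`-algebra on the paths of `Λ` for which the Cuntz-Krieger
relations hold in the quotient by the null space. -/
def ckSeminorms : Set (CStarSeminorm (FreeStarAlg (Path Λ))) :=
  {N | ∀ x y, CKRel (freeGen (Λ := Λ)) x y → N (x - y) = 0}

theorem ckSeminorms_nonempty : (ckSeminorms Λ).Nonempty :=
  ⟨CStarSeminorm.zero, fun _ _ _ => rfl⟩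

theorem seminorm_eq_of_sub {F : Type*} [NonUnitalRing F] [StarRing F] [Module ℂ F]
    (N : CStarSeminorm F) {x y : F} (h : N (x - y) = 0) : N x = N y := by
  have h1 := map_add_le_add N (x - y) y
  have h2 := map_add_le_add N (-(x - y)) x
  rw [map_neg_eq_map] at h2
  simp only [sub_add_cancel, neg_sub, h, zero_add] at h1 h2
  exact le_antisymm h1 h2

variable {Λ}

theorem ck_gen_le_one {N : CStarSeminorm (FreeStarAlg (Path Λ))} (hN : N ∈ ckSeminorms Λ)
    {a b : Λ} (l : a ⟶ b) : N (freeGen l) ≤ 1 := by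
  have key : ∀ c : Λ, N (freeGen (𝟙 c)) ^ 2 = N (freeGen (𝟙 c)) := fun c => by
    rw [← N.star_mul_self]
    exact seminorm_eq_of_sub N (hN _ _ (CKRel.star_mul (t := freeGen) (𝟙 c)))
  have h2 : N (freeGen l) ^ 2 = N (freeGen (𝟙 a)) := by
    rw [← N.star_mul_self]
    exact seminorm_eq_of_sub N (hN _ _ (CKRel.star_mul (t := freeGen) l))
  have h3 : N (freeGen (𝟙 a)) ≤ 1 := by nlinarith [key a, apply_nonneg N (freeGen (𝟙 a))]
  nlinarith [apply_nonneg N (freeGen l)]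

theorem ck_word_le_one {N : CStarSeminorm (FreeStarAlg (Path Λ))} (hN : N ∈ ckSeminorms Λ)
    (w : FreeSemigroup (Path Λ × Bool)) : N (FreeStarAlg.mono w 1) ≤ 1 := by
  have h1 : ∀ p : Path Λ × Bool, N (FreeStarAlg.mono (FreeSemigroup.of p) 1) ≤ 1 := by
    rintro ⟨⟨a, b, l⟩, _ | _⟩
    · exact ck_gen_le_one hN l
    · rw [← FreeStarAlg.star_gen, N.star_eq]; exact ck_gen_le_one hN l
  induction w with
  | ih1 p => exact h1 p
  | ih2 p w _ h =>
    have : FreeStarAlg.mono (FreeSemigroup.of p * w) 1 =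
        FreeStarAlg.mono (FreeSemigroup.of p) 1 * FreeStarAlg.mono w 1 := by
      rw [FreeStarAlg.mono_mul, one_mul]
    rw [this]
    exact (N.mul_le _ _).trans (mul_le_one₀ (h1 p) (apply_nonneg _ _) h)

variable (Λ)

theorem ckSeminorms_bdd (x : FreeStarAlg (Path Λ)) :
    BddAbove (Set.range fun N : ckSeminorms Λ => N.1 x) := by
  induction x using FreeStarAlg.ind with
  | hm w c =>
    refine ⟨‖c‖, ?_⟩
    rintro _ ⟨N, rfl⟩
    have : FreeStarAlg.mono w c = c • FreeStarAlg.mono w 1 := by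
      rw [FreeStarAlg.smul_mono, mul_one]
    simp only [this, map_smul_eq_mul]
    exact mul_le_of_le_one_right (norm_nonneg c) (ck_word_le_one N.2 w)
  | h0 => exact ⟨0, by rintro _ ⟨N, rfl⟩; simp⟩
  | ha x y hx hy =>
    obtain ⟨M, hM⟩ := hx
    obtain ⟨M', hM'⟩ := hy
    refine ⟨M + M', ?_⟩
    rintro _ ⟨N, rfl⟩
    exact (map_add_le_add N.1 x y).trans (add_le_add (hM ⟨N, rfl⟩) (hM' ⟨N, rfl⟩))

/-- The largest `C*`-seminorm on the free `*`-algebra on the paths of `Λ` that is compatible with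
the Cuntz-Krieger relations. -/
noncomputable def ckSeminorm : CStarSeminorm (FreeStarAlg (Path Λ)) :=
  CStarSeminorm.sup (ckSeminorms Λ) (ckSeminorms_nonempty Λ) (ckSeminorms_bdd Λ)

/-- `C*(Λ)`, the universal `C*`-algebra generated by a Cuntz-Krieger `Λ`-family. -/
abbrev CStar : Type (max u v) := (ckSeminorm Λ).Envelope

variable {Λ}

/-- The universal Cuntz-Krieger family in `C*(Λ)`. -/
noncomputable def univ ⦃a b : Λ⦄ (l : a ⟶ b) : CStar Λ :=
  CStarSeminorm.Envelope.ι (N := ckSeminorm Λ) (freeGen l)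

/-- The elements `univ l` form a Cuntz-Krieger family in `C*(Λ)`. -/
theorem isCuntzKriegerFamily_univ : IsCuntzKriegerFamily (univ (Λ := Λ)) := by
  intro x y h
  obtain ⟨a, b, hab, rfl, rfl⟩ : ∃ a b, CKRel (freeGen (Λ := Λ)) a b ∧
      CStarSeminorm.Envelope.ι (N := ckSeminorm Λ) a = x ∧
      CStarSeminorm.Envelope.ι (N := ckSeminorm Λ) b = y := by
    cases h with
    | partial_isometry l => exact ⟨_, _, .partial_isometry l, by
        simp only [CStarSeminorm.Envelope.ι_mul, CStarSeminorm.Envelope.ι_star]; rfl, rfl⟩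
    | vertex_star w => exact ⟨_, _, .vertex_star w, CStarSeminorm.Envelope.ι_star _, rfl⟩
    | vertex_idem w => exact ⟨_, _, .vertex_idem w, CStarSeminorm.Envelope.ι_mul _ _, rfl⟩
    | vertex_orth h => exact ⟨_, _, .vertex_orth h, CStarSeminorm.Envelope.ι_mul _ _,
        CStarSeminorm.Envelope.ι_zero⟩
    | mul ν μ => exact ⟨_, _, .mul ν μ, CStarSeminorm.Envelope.ι_mul _ _, rfl⟩
    | star_mul l => exact ⟨_, _, .star_mul l, by
        simp only [CStarSeminorm.Envelope.ι_mul, CStarSeminorm.Envelope.ι_star]; rfl, rfl⟩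
    | sum w n => exact ⟨_, _, .sum w n, rfl, by
        rw [show CStarSeminorm.Envelope.ι (N := ckSeminorm Λ) _ = _ from
          map_sum (CStarSeminorm.Envelope.ιHom (ckSeminorm Λ)) _ _]
        change ∑ p ∈ _, CStarSeminorm.Envelope.ι (N := ckSeminorm Λ) _ = _
        simp only [CStarSeminorm.Envelope.ι_mul, CStarSeminorm.Envelope.ι_star]; rfl⟩
  have h0 : ckSeminorm Λ (a - b) = 0 := by
    have : Nonempty (ckSeminorms Λ) := (ckSeminorms_nonempty Λ).to_subtype
    change (⨆ N : ckSeminorms Λ, N.1 (a - b)) = 0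
    simp only [fun N : ckSeminorms Λ => N.2 _ _ hab, ciSup_const]
  rw [← sub_eq_zero, ← norm_eq_zero]
  refine Eq.trans ?_ h0
  rw [← CStarSeminorm.Envelope.norm_ι]
  exact congrArg norm (map_sub (CStarSeminorm.Envelope.ιHom (ckSeminorm Λ)) a b).symm

/-- The universal property of `C*(Λ)`: every Cuntz-Krieger family in a `C*`-algebra is the image of
the family `univ` under a unique `*`-homomorphism. -/
theorem existsUnique_lift {A : Type*} [NonUnitalCStarAlgebra A] (s : ∀ ⦃a b : Λ⦄, (a ⟶ b) → A)
    (hs : IsCuntzKriegerFamily s) :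
    ∃! π : CStar Λ →⋆ₙₐ[ℂ] A, ∀ ⦃a b : Λ⦄ (l : a ⟶ b), π (univ l) = s l := by
  obtain ⟨φ, hφ⟩ := FreeStarAlg.exists_lift (fun p : Path Λ => s p.2.2)
  have hφ' : ∀ ⦃a b : Λ⦄ (l : a ⟶ b), φ (freeGen l) = s l := fun a b l => hφ ⟨a, b, l⟩
  have hrel : ∀ x y, CKRel (freeGen (Λ := Λ)) x y → φ x = φ y := by
    intro x y h
    apply hs
    cases h with
    | partial_isometry l => simp only [map_mul, map_star, hφ']; exact .partial_isometry l
    | vertex_star w => simp only [map_star, hφ']; exact .vertex_star w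
    | vertex_idem w => simp only [map_mul, hφ']; exact .vertex_idem w
    | vertex_orth h => simp only [map_mul, map_zero, hφ']; exact .vertex_orth h
    | mul ν μ => simp only [map_mul, hφ']; exact .mul ν μ
    | star_mul l => simp only [map_mul, map_star, hφ']; exact .star_mul l
    | sum w n => simp only [map_sum, map_mul, map_star, hφ']; exact .sum w n
  have hmem : CStarSeminorm.comap φ ∈ ckSeminorms Λ := fun x y h => by
    change ‖φ (x - y)‖ = 0
    rw [map_sub, hrel x y h, sub_self, norm_zero]
  obtain ⟨π, hπ, huniq⟩ := CStarSeminorm.Envelope.existsUnique_lift (N := ckSeminorm Λ) φ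
    (fun a => CStarSeminorm.le_sup (ckSeminorms_nonempty Λ) (ckSeminorms_bdd Λ) hmem a)
  refine ⟨π, fun a b l => (hπ _).trans (hφ' l), fun π' h' => huniq π' fun a => ?_⟩
  have : (π'.comp (CStarSeminorm.Envelope.ιHom (ckSeminorm Λ))) = φ :=
    FreeStarAlg.hom_ext fun p => (h' p.2.2).trans (hφ p).symm
  exact DFunLike.congr_fun this a

end CK
end KGraph

/-! ### Inductive limits of Hilbert spaces -/

section HilbertLimit

variable {I : Type*} [Preorder I] [IsDirectedOrder I] {E : I → Type*}
  [∀ i, NormedAddCommGroup (E i)] [∀ i, InnerProductSpace ℂ (E i)]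
  (f : ∀ i j, i ≤ j → E i →ₗᵢ[ℂ] E j) [DirectedSystem E (f · · ·)]

/-- The algebraic direct limit (disjoint union modulo eventual equality) of a directed system of
inner product spaces and linear isometries. -/
def AlgLimit : Type _ := DirectLimit E f

namespace AlgLimit

/-- The class in the direct limit of an element of the `i`-th space. -/
def mk (i : I) (a : E i) : AlgLimit f := (⟦⟨i, a⟩⟧ : DirectLimit E f)

theorem mk_map {i j : I} (h : i ≤ j) (a : E i) : mk f j (f i j h a) = mk f i a :=
  (DirectLimit.eq_of_le (f := f) ⟨i, a⟩ j h).symm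

/-- The inner product of the classes of `a, b ∈ E i` is their inner product in `E i`. -/
noncomputable instance : Inner ℂ (AlgLimit f) where
  inner := DirectLimit.lift₂ f f (fun _ a b => inner ℂ a b)
    (fun i j h a b => ((f i j h).inner_map_map a b).symm)

theorem inner_mk (i : I) (a b : E i) : inner ℂ (mk f i a) (mk f i b) = inner ℂ a b :=
  DirectLimit.lift₂_def f f _ _ i a b

theorem ind {P : AlgLimit f → Prop} (h : ∀ i a, P (mk f i a)) (x : AlgLimit f) : P x :=
  DirectLimit.induction f h x

theorem ind₂ {P : AlgLimit f → AlgLimit f → Prop} (h : ∀ i a b, P (mk f i a) (mk f i b))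
    (x y : AlgLimit f) : P x y :=
  DirectLimit.induction₂ f h x y

theorem ind₃ {P : AlgLimit f → AlgLimit f → AlgLimit f → Prop}
    (h : ∀ i a b c, P (mk f i a) (mk f i b) (mk f i c)) (x y z : AlgLimit f) : P x y z :=
  DirectLimit.induction₃ f h x y z

theorem conj_inner (x y : AlgLimit f) : conj (inner ℂ y x) = inner ℂ x y :=
  ind₂ f (P := fun x y => conj (inner ℂ y x) = inner ℂ x y)
    (fun i a b => by simp only [inner_mk, inner_conj_symm]) x y

theorem inner_nonneg (x : AlgLimit f) : 0 ≤ RCLike.re (inner ℂ x x) :=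
  ind f (P := fun x => 0 ≤ RCLike.re (inner ℂ x x))
    (fun i a => by rw [inner_mk]; exact inner_self_nonneg) x

variable [Nonempty I]

noncomputable instance : AddCommGroup (AlgLimit f) := inferInstanceAs (AddCommGroup (DirectLimit E f))
noncomputable instance : Module ℂ (AlgLimit f) := inferInstanceAs (Module ℂ (DirectLimit E f))

theorem mk_add (i : I) (a b : E i) : mk f i (a + b) = mk f i a + mk f i b :=
  (DirectLimit.add_def i a b).symm

theorem mk_smul (i : I) (c : ℂ) (a : E i) : mk f i (c • a) = c • mk f i a :=
  (DirectLimit.smul_def i a c).symm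

theorem mk_zero (i : I) : mk f i 0 = 0 := (DirectLimit.zero_def i).symm

theorem inner_add (x y z : AlgLimit f) : inner ℂ (x + y) z = inner ℂ x z + inner ℂ y z :=
  ind₃ f (P := fun x y z => inner ℂ (x + y) z = inner ℂ x z + inner ℂ y z)
    (fun i a b c => by simp only [← mk_add, inner_mk, inner_add_left]) x y z

theorem inner_smul (x y : AlgLimit f) (c : ℂ) : inner ℂ (c • x) y = conj c * inner ℂ x y :=
  ind₂ f (P := fun x y => inner ℂ (c • x) y = conj c * inner ℂ x y)
    (fun i a b => by simp only [← mk_smul, inner_mk, inner_smul_left]) x y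

theorem inner_definite (x : AlgLimit f) : inner ℂ x x = 0 → x = 0 :=
  ind f (P := fun x => inner ℂ x x = 0 → x = 0)
    (fun i a h => by rw [inner_mk, inner_self_eq_zero] at h; rw [h, mk_zero]) x

noncomputable instance core : InnerProductSpace.Core ℂ (AlgLimit f) where
  __ := (inferInstance : Inner ℂ (AlgLimit f))
  conj_inner_symm := conj_inner f
  re_inner_nonneg := inner_nonneg f
  add_left := inner_add f
  smul_left := inner_smul f
  definite := inner_definite f

noncomputable instance : NormedAddCommGroup (AlgLimit f) :=
  (core f).toNormedAddCommGroup

noncomputable instance : InnerProductSpace ℂ (AlgLimit f) :=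
  InnerProductSpace.ofCore (core f).toCore

end AlgLimit

/-- The inductive limit Hilbert space of a directed system of inner product spaces and linear
isometries: the completion of the algebraic direct limit. -/
abbrev HilbertLimit [Nonempty I] : Type _ := UniformSpace.Completion (AlgLimit f)

/-- The class in the inductive limit Hilbert space of an element of the `i`-th space. -/
noncomputable def HilbertLimit.mk [Nonempty I] (i : I) (a : E i) : HilbertLimit f :=
  UniformSpace.Completion.coe' (AlgLimit.mk f i a)

end HilbertLimit

/-! ### The Hilbert space of an infinite path -/

namespace KGraph
namespace InfinitePath

variable {k : ℕ} {Λ : Type u} [Category.{v} Λ] [KGraph k Λ] (x : InfinitePath Λ)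

/-- The point `(i, …, i)` of `ℕ^k`. -/
def diag (k i : ℕ) : Omega k := ⟨fun _ => i⟩

/-- The vertex `v_i = x(i, …, i)`. -/
def vertex (i : ℕ) : Λ := x.toFunctor.obj (diag k i)

/-- The path `x((i, …, i), (j, …, j))`, with range `v_i` and source `v_j`. Writing
`x = x_0 x_1 x_2 ⋯` with `d(x_i) = (1, …, 1)`, this is `x_i x_{i+1} ⋯ x_{j-1}`. -/
def segment {i j : ℕ} (h : i ≤ j) : x.vertex j ⟶ x.vertex i :=
  x.toFunctor.map (X := diag k j) (Y := diag k i) ⟨fun _ => h⟩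

theorem segment_comp {i j l : ℕ} (hij : i ≤ j) (hjl : j ≤ l) :
    x.segment hjl ≫ x.segment hij = x.segment (hij.trans hjl) :=
  (x.toFunctor.map_comp _ _).symm

theorem segment_self (i : ℕ) : x.segment (le_refl i) = 𝟙 _ := x.toFunctor.map_id _

/-- The set `F_i = Λ v_i` of paths with source `v_i`. -/
abbrev F (i : ℕ) : Type (max u v) := Σ w : Λ, (x.vertex i ⟶ w)

/-- The Hilbert space `ℓ²(F_i)`. -/
abbrev L2 (i : ℕ) : Type (max u v) := lp (fun _ : x.F i => ℂ) 2

open Classical in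
/-- The standard basis vector `ξ^i_μ` of `ℓ²(F_i)`. -/
noncomputable def basisVec (i : ℕ) (μ : x.F i) : x.L2 i := lp.single 2 μ 1

/-- The map `F_i → F_j`, `μ ↦ μ x_i ⋯ x_{j-1}`. -/
def append {i j : ℕ} (h : i ≤ j) (μ : x.F i) : x.F j := ⟨μ.1, x.segment h ≫ μ.2⟩

theorem append_injective {i j : ℕ} (h : i ≤ j) : Function.Injective (x.append h) := by
  rintro ⟨w, μ⟩ ⟨w', μ'⟩ heq
  obtain rfl : w = w' := congrArg Sigma.fst heq
  have h1 : x.segment h ≫ μ = x.segment h ≫ μ' := by simpa [append] using heq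
  obtain ⟨p, -, hp⟩ := KGraph.factorization (x.segment h ≫ μ) (KGraph.deg μ)
    (KGraph.deg (x.segment h)) (KGraph.deg_comp _ _)
  have hd : KGraph.deg μ' = KGraph.deg μ := by
    have := congrArg KGraph.deg h1
    rw [KGraph.deg_comp, KGraph.deg_comp] at this
    exact (add_right_cancel this).symm
  have e1 := hp ⟨_, x.segment h, μ⟩ ⟨rfl, rfl, rfl⟩
  have e2 := hp ⟨_, x.segment h, μ'⟩ ⟨hd, rfl, h1.symm⟩
  have e3 := e1.trans e2.symm
  simpa using e3

theorem orthonormal_append {i j : ℕ} (h : i ≤ j) :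
    Orthonormal ℂ fun μ : x.F i => x.basisVec j (x.append h μ) := by
  classical
  rw [orthonormal_iff_ite]
  intro μ μ'
  rw [basisVec, lp.inner_single_left]
  simp [basisVec, lp.single_apply, Pi.single_apply, (x.append_injective h).eq_iff]

/-- The linear isometry `ρ_{j-1} ⋯ ρ_i : ℓ²(F_i) → ℓ²(F_j)`, which takes the basis vector `ξ^i_μ` to
`ξ^j_{μ x_i ⋯ x_{j-1}}`; in particular, it is `ρ_i` for `j = i + 1`. -/
noncomputable def trans (i j : ℕ) (h : i ≤ j) : x.L2 i →ₗᵢ[ℂ] x.L2 j :=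
  (x.orthonormal_append h).orthogonalFamily.linearIsometry

theorem trans_basisVec {i j : ℕ} (h : i ≤ j) (μ : x.F i) :
    x.trans i j h (x.basisVec i μ) = x.basisVec j (x.append h μ) := by
  classical
  rw [trans, basisVec, OrthogonalFamily.linearIsometry_apply_single]
  simp

theorem ext_basisVec {i : ℕ} {E : Type*} [NormedAddCommGroup E] [NormedSpace ℂ E]
    {S T : x.L2 i →L[ℂ] E} (h : ∀ μ, S (x.basisVec i μ) = T (x.basisVec i μ)) : S = T := by
  classical
  ext a
  have hs := lp.hasSum_single (p := 2) (by simp) a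
  have key : ∀ μ, (lp.single 2 μ (a μ) : x.L2 i) = a μ • x.basisVec i μ := fun μ => by
    rw [basisVec, ← lp.single_smul, smul_eq_mul, mul_one]
  have h1 := S.hasSum hs
  have h2 := T.hasSum hs
  simp only [key, map_smul, h] at h1 h2
  exact h1.unique h2

instance : DirectedSystem x.L2 (x.trans · · ·) where
  map_self i a := by
    have : (x.trans i i le_rfl).toContinuousLinearMap = ContinuousLinearMap.id ℂ _ :=
      x.ext_basisVec fun μ => by
        simp [trans_basisVec, append, segment_self]
    exact congrArg (fun S : x.L2 i →L[ℂ] x.L2 i => S a) this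
  map_map l j i hij hjl a := by
    have : (x.trans j l hjl).toContinuousLinearMap.comp (x.trans i j hij).toContinuousLinearMap =
        (x.trans i l (hij.trans hjl)).toContinuousLinearMap :=
      x.ext_basisVec fun μ => by
        simp [trans_basisVec, append, ← Category.assoc, segment_comp]
    exact congrArg (fun S : x.L2 i →L[ℂ] x.L2 l => S a) this

/-- The inductive limit Hilbert space `H_x` of the spaces `ℓ²(F_i)`. -/
abbrev H : Type (max u v) := HilbertLimit x.trans

/-- The class `[ξ^i_μ]` in `H_x` of the basis vector `ξ^i_μ` of `ℓ²(F_i)`. -/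
noncomputable def ξ (i : ℕ) {w : Λ} (μ : x.vertex i ⟶ w) : x.H :=
  HilbertLimit.mk x.trans i (x.basisVec i ⟨w, μ⟩)

/-- `T` consists of the prefixing operators on `H_x`: `T_λ [ξ^i_μ] = [ξ^i_{λμ}]` if `s(λ) = r(μ)`,
and `T_λ [ξ^i_μ] = 0` otherwise. -/
def IsPrefixing (T : ∀ ⦃a b : Λ⦄, (a ⟶ b) → (x.H →L[ℂ] x.H)) : Prop :=
  (∀ ⦃a b : Λ⦄ (l : a ⟶ b) (i : ℕ) (μ : x.vertex i ⟶ a), T l (x.ξ i μ) = x.ξ i (μ ≫ l)) ∧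
  ∀ ⦃a b : Λ⦄ (l : a ⟶ b) (i : ℕ) (w : Λ) (μ : x.vertex i ⟶ w), w ≠ a → T l (x.ξ i μ) = 0

end InfinitePath
end KGraph

/-!
Identify each path `μ` with source `v_i` with its continuations `μ x_i ⋯ x_{j-1}`. The resulting
germs index an orthonormal basis of `H_x`, and `T_λ` is the partial isometry that prefixes `λ` to a
germ. By unique factorization, every germ of range `w` starts with exactly one path of degree `n`,
which is the relation `t_w = ∑ t_λ t_λ*`.

Injectivity is the gauge-invariant uniqueness argument. A germ has a well-defined degree
`d(μ) - (i, …, i)` in `ℤ^k` even if `x` is periodic, and the unitary that multiplies the basis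
vector of `g` by `z ^ deg g` conjugates `T_λ` to `z ^ d(λ) T_λ`. Hence the kernel of `π_x` is
invariant under the gauge action, and so it contains all the Fourier coefficients of the orbit of
each of its elements `y`. If `y_n` is such a coefficient, then `y_n* y_n` lies in the core, the
closed union of the levels spanned by the `t_α t_β*` with `d(α) = d(β) = m`. Compressing by
`t_β*` and `t_α'` takes a level into multiples of vertex projections, which `π_x` does not kill, so
`π_x` is isometric on the core. Thus all `y_n` vanish, and then so does `y`.
-/

section CStarAlgebra

variable {A : Type*} [NonUnitalCStarAlgebra A]

theorem continuous_nonUnitalStarAlgHom {B : Type*} [NonUnitalCStarAlgebra B] (φ : A →⋆ₙₐ[ℂ] B) :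
    Continuous φ :=
  AddMonoidHomClass.continuous_of_bound φ 1 fun a => by
    rw [one_mul]
    exact NonUnitalStarAlgHom.norm_apply_le φ a

theorem mul_eq_zero_of_mul_sum_eq_self {ι : Type*} {s : Finset ι} {p : ι → A}
    (hp : ∀ i ∈ s, IsStarProjection (p i)) {i j : ι} (hi : i ∈ s) (hj : j ∈ s) (hij : i ≠ j)
    (hsum : p i * ∑ n ∈ s, p n = p i) : p j * p i = 0 := by
  classical
  let _ := CStarAlgebra.spectralOrder A
  have _ := CStarAlgebra.spectralOrderedRing A
  have compression_eq : ∀ n ∈ s, p i * p n * p i = star (p n * p i) * (p n * p i) := fun n hn => by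
    rw [star_mul, (hp i hi).isSelfAdjoint.star_eq, (hp n hn).isSelfAdjoint.star_eq, mul_assoc,
      mul_assoc, ← mul_assoc (p n) (p n), (hp n hn).isIdempotentElem.eq]
  have sum_erase : ∑ n ∈ s.erase i, p i * p n * p i = 0 := by
    rw [← Finset.add_sum_erase s p hi, mul_add, (hp i hi).isIdempotentElem.eq,
      add_eq_left] at hsum
    rw [← Finset.sum_mul, ← Finset.mul_sum, hsum, zero_mul]
  have compression_eq_zero : p i * p j * p i = 0 :=
    (Finset.sum_eq_zero_iff_of_nonneg fun n hn => by
      rw [compression_eq n (Finset.mem_of_mem_erase hn)]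
      exact star_mul_self_nonneg _).1 sum_erase j (Finset.mem_erase.2 ⟨hij.symm, hj⟩)
  rwa [compression_eq j hj, CStarRing.star_mul_self_eq_zero_iff] at compression_eq_zero

end CStarAlgebra

namespace KGraph
namespace IsCuntzKriegerFamily

variable {k : ℕ} {Λ : Type u} [Category.{v} Λ] [KGraph k Λ] [RowFinite Λ]

section

variable {A : Type*} [NonUnitalRing A] [StarRing A] {t : ∀ ⦃a b : Λ⦄, (a ⟶ b) → A}

theorem mul_star_mul (ht : IsCuntzKriegerFamily t) {a b : Λ} (l : a ⟶ b) :
    t l * star (t l) * t l = t l := ht _ _ (.partial_isometry l)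

theorem star_id (ht : IsCuntzKriegerFamily t) (w : Λ) : star (t (𝟙 w)) = t (𝟙 w) :=
  ht _ _ (.vertex_star w)

theorem id_mul_id_of_ne (ht : IsCuntzKriegerFamily t) {w w' : Λ} (h : w ≠ w') :
    t (𝟙 w) * t (𝟙 w') = 0 := ht _ _ (.vertex_orth h)

theorem map_comp (ht : IsCuntzKriegerFamily t) {a b c : Λ} (ν : a ⟶ b) (μ : b ⟶ c) :
    t (ν ≫ μ) = t μ * t ν := (ht _ _ (.mul ν μ)).symm

theorem star_mul_self (ht : IsCuntzKriegerFamily t) {a b : Λ} (l : a ⟶ b) :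
    star (t l) * t l = t (𝟙 a) := ht _ _ (.star_mul l)

theorem id_eq_sum (ht : IsCuntzKriegerFamily t) (w : Λ) (n : Fin k → ℕ) : t (𝟙 w) =
    ∑ p ∈ (RowFinite.finite_pathsInto w n).toFinset, t p.2 * star (t p.2) := ht _ _ (.sum w n)

theorem mul_id (ht : IsCuntzKriegerFamily t) {a b : Λ} (l : a ⟶ b) : t l * t (𝟙 a) = t l := by
  rw [← ht.map_comp, Category.id_comp]

theorem id_mul (ht : IsCuntzKriegerFamily t) {a b : Λ} (l : a ⟶ b) : t (𝟙 b) * t l = t l := by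
  rw [← ht.map_comp, Category.comp_id]

theorem id_mul_star (ht : IsCuntzKriegerFamily t) {a b : Λ} (l : a ⟶ b) :
    t (𝟙 a) * star (t l) = star (t l) := by
  rw [← ht.star_id, ← star_mul, ht.mul_id]

theorem star_mul_id (ht : IsCuntzKriegerFamily t) {a b : Λ} (l : a ⟶ b) :
    star (t l) * t (𝟙 b) = star (t l) := by
  rw [← ht.star_id, ← star_mul, ht.id_mul]

theorem star_mul_eq_zero_of_range_ne (ht : IsCuntzKriegerFamily t) {a b c d : Λ} (l : a ⟶ b)
    (m : c ⟶ d) (h : b ≠ d) : star (t l) * t m = 0 := by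
  rw [← ht.star_mul_id l, ← ht.id_mul m, mul_assoc, ← mul_assoc (t (𝟙 b)), ht.id_mul_id_of_ne h,
    zero_mul, mul_zero]

theorem isStarProjection_mul_star (ht : IsCuntzKriegerFamily t) {a b : Λ} (l : a ⟶ b) :
    IsStarProjection (t l * star (t l)) where
  isIdempotentElem := by rw [IsIdempotentElem, ← mul_assoc, ht.mul_star_mul]
  isSelfAdjoint := IsSelfAdjoint.mul_star_self _

theorem mul_star_eq_sum (ht : IsCuntzKriegerFamily t) {e a b : Λ} (α : e ⟶ a) (β : e ⟶ b)
    (n : Fin k → ℕ) : t α * star (t β) =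
      ∑ p ∈ (RowFinite.finite_pathsInto e n).toFinset, t (p.2 ≫ α) * star (t (p.2 ≫ β)) := by
  conv_lhs => rw [← ht.mul_id α, ht.id_eq_sum e n, Finset.mul_sum, Finset.sum_mul]
  simp only [ht.map_comp, star_mul, mul_assoc]

end

section

variable {A : Type*} [NonUnitalCStarAlgebra A] {t : ∀ ⦃a b : Λ⦄, (a ⟶ b) → A}

theorem star_mul_eq_zero_of_ne (ht : IsCuntzKriegerFamily t) {a a' b b' : Λ} (l : a ⟶ b)
    (l' : a' ⟶ b') (hd : deg l = deg l') (h : (⟨a, b, l⟩ : Path Λ) ≠ ⟨a', b', l'⟩) :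
    star (t l) * t l' = 0 := by
  rcases eq_or_ne b b' with rfl | hb
  swap
  · exact ht.star_mul_eq_zero_of_range_ne l l' hb
  have hmem : ∀ p : Σ a, a ⟶ b, p ∈ (RowFinite.finite_pathsInto b (deg l)).toFinset ↔
      deg p.2 = deg l := fun p => by rw [Set.Finite.mem_toFinset, pathsInto, Set.mem_ofPred_eq]
  have ranges_orthogonal : t l * star (t l) * (t l' * star (t l')) = 0 :=
    mul_eq_zero_of_mul_sum_eq_self (s := (RowFinite.finite_pathsInto b (deg l)).toFinset)
      (p := fun p : Σ a, a ⟶ b => t p.2 * star (t p.2))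
      (fun p _ => ht.isStarProjection_mul_star p.2) (i := ⟨a', l'⟩) (j := ⟨a, l⟩)
      ((hmem _).2 hd.symm) ((hmem _).2 rfl) (fun hl => h (by cases hl; rfl))
      (by rw [← ht.id_eq_sum, mul_assoc, ht.star_mul_id])
  calc star (t l) * t l'
      = star (t l) * (t l * star (t l) * (t l' * star (t l'))) * t l' := by
        simp only [← mul_assoc]
        rw [ht.star_mul_self, ht.id_mul_star, mul_assoc _ (t l'), mul_assoc, ht.mul_star_mul]
    _ = 0 := by rw [ranges_orthogonal, mul_zero, zero_mul]

theorem star_mul_eq_zero_or_exists_deg_add (ht : IsCuntzKriegerFamily t) {a b e d : Λ} (l : a ⟶ b)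
    (p : e ⟶ d) (h : deg l ≤ deg p) : star (t l) * t p = 0 ∨
      ∃ α : e ⟶ a, deg l + deg α = deg p ∧ star (t l) * t p = t α := by
  obtain ⟨⟨w, α, l'⟩, ⟨hl', hα, hp⟩, -⟩ := KGraph.factorization p (deg l) (deg p - deg l)
    (add_tsub_cancel_of_le h).symm
  simp only at hl' hα hp
  subst hp
  rw [ht.map_comp, ← mul_assoc]
  rcases eq_or_ne (⟨a, b, l⟩ : Path Λ) ⟨w, d, l'⟩ with hll' | hll'
  · cases hll'
    exact .inr ⟨α, (deg_comp α l).symm, by rw [ht.star_mul_self, ht.id_mul]⟩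
  · exact .inl (by rw [ht.star_mul_eq_zero_of_ne l l' hl'.symm hll', zero_mul])

theorem star_mul_mem_span (ht : IsCuntzKriegerFamily t) {a b c d : Λ} (l : a ⟶ b) (m : c ⟶ d) :
    star (t l) * t m ∈ Submodule.span ℂ {y | ∃ (e : Λ) (α : e ⟶ a) (β : e ⟶ c),
      deg l + deg α = deg l ⊔ deg m ∧ deg m + deg β = deg l ⊔ deg m ∧ y = t α * star (t β)} := by
  -- Expanding the range projection over `bΛ^{d(l) ∨ d(m)}` makes `l` and `m` both prefixes.
  have expansion : star (t l) * t m =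
      ∑ p ∈ (RowFinite.finite_pathsInto b (deg l ⊔ deg m)).toFinset,
        star (t l) * t p.2 * star (star (t m) * t p.2) := by
    conv_lhs => rw [← ht.star_mul_id, ht.id_eq_sum b (deg l ⊔ deg m), Finset.mul_sum,
      Finset.sum_mul]
    simp only [mul_assoc, star_mul, star_star]
  rw [expansion]
  refine Submodule.sum_mem _ fun ⟨e, p⟩ hp => ?_
  have hp : deg p = deg l ⊔ deg m := by
    rwa [Set.Finite.mem_toFinset, pathsInto, Set.mem_ofPred_eq] at hp
  rw [← hp]
  rcases ht.star_mul_eq_zero_or_exists_deg_add l p (hp ▸ le_sup_left) with hl | ⟨α, hα, hl⟩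
  · rw [hl, zero_mul]
    exact zero_mem _
  rcases ht.star_mul_eq_zero_or_exists_deg_add m p (hp ▸ le_sup_right) with hm | ⟨β, hβ, hm⟩
  · rw [hm, star_zero, mul_zero]
    exact zero_mem _
  · exact Submodule.subset_span ⟨e, α, β, hα, hβ, by rw [hl, hm]⟩

end

end IsCuntzKriegerFamily

/-! ### Spans of the products `t_α t_β*` and the core -/

section

variable {k : ℕ} {Λ : Type u} [Category.{v} Λ] [KGraph k Λ] {A : Type*} [NonUnitalCStarAlgebra A]

/-- The span of the products `t_α t_β*` whose degrees satisfy the relation `R`. It is the common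
generalization of the homogeneous components, the levels of the core and the span of all products,
so that products and adjoints need to be computed only once. -/
def mulStarSpan (t : ∀ ⦃a b : Λ⦄, (a ⟶ b) → A) (R : (Fin k → ℕ) → (Fin k → ℕ) → Prop) :
    Submodule ℂ A :=
  Submodule.span ℂ {y | ∃ (e a b : Λ) (α : e ⟶ a) (β : e ⟶ b),
    R (deg α) (deg β) ∧ y = t α * star (t β)}

/-- The homogeneous component of degree `n`, spanned by the products `t_α t_β*` with
`d(α) - d(β) = n`. -/
abbrev gradedSpan (t : ∀ ⦃a b : Λ⦄, (a ⟶ b) → A) (n : Fin k → ℤ) : Submodule ℂ A :=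
  mulStarSpan t fun p q => (fun i => (p i : ℤ) - q i) = n

/-- The level `m` of the core, spanned by the products `t_α t_β*` with `d(α) = d(β) = m`. -/
abbrev levelSpan (t : ∀ ⦃a b : Λ⦄, (a ⟶ b) → A) (m : Fin k → ℕ) : Submodule ℂ A :=
  mulStarSpan t fun p q => p = m ∧ q = m

variable {t : ∀ ⦃a b : Λ⦄, (a ⟶ b) → A} {R R' R'' : (Fin k → ℕ) → (Fin k → ℕ) → Prop}

theorem mul_star_mem_mulStarSpan {e a b : Λ} (α : e ⟶ a) (β : e ⟶ b) (h : R (deg α) (deg β)) :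
    t α * star (t β) ∈ mulStarSpan t R :=
  Submodule.subset_span ⟨e, a, b, α, β, h, rfl⟩

theorem mulStarSpan_le {S : Submodule ℂ A} (h : ∀ {e a b : Λ} (α : e ⟶ a) (β : e ⟶ b),
    R (deg α) (deg β) → t α * star (t β) ∈ S) : mulStarSpan t R ≤ S :=
  Submodule.span_le.2 (by rintro _ ⟨e, a, b, α, β, hR, rfl⟩; exact h α β hR)

theorem star_mem_mulStarSpan (hR : ∀ p q, R p q → R' q p) {y : A} (hy : y ∈ mulStarSpan t R) :
    star y ∈ mulStarSpan t R' := by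
  induction hy using Submodule.span_induction with
  | zero => rw [star_zero]; exact zero_mem _
  | add y z _ _ hy hz => rw [star_add]; exact add_mem hy hz
  | smul c y _ hy => rw [star_smul]; exact Submodule.smul_mem _ _ hy
  | mem y hy =>
    obtain ⟨e, a, b, α, β, h, rfl⟩ := hy
    rw [star_mul, star_star]
    exact mul_star_mem_mulStarSpan β α (hR _ _ h)

theorem gradedSpan_zero_le_iSup_levelSpan : gradedSpan t 0 ≤ ⨆ m, levelSpan t m := by
  refine mulStarSpan_le fun α β h => Submodule.mem_iSup_of_mem (deg α)
    (mul_star_mem_mulStarSpan α β ⟨rfl, funext fun i => ?_⟩)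
  exact_mod_cast (sub_eq_zero.1 (congrFun h i)).symm

variable [RowFinite Λ]

namespace IsCuntzKriegerFamily

theorem mul_mem_mulStarSpan (ht : IsCuntzKriegerFamily t)
    (hR : ∀ p q p' q' r s, R p q → R' p' q' → q + r = q ⊔ p' → p' + s = q ⊔ p' →
      R'' (p + r) (q' + s)) {y z : A} (hy : y ∈ mulStarSpan t R) (hz : z ∈ mulStarSpan t R') :
    y * z ∈ mulStarSpan t R'' := by
  refine LinearMap.BilinMap.apply_apply_mem_of_mem_span _ _ _ (LinearMap.mul ℂ A) ?_ y z hy hz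
  rintro _ ⟨e, a, b, α, β, hR₁, rfl⟩ _ ⟨e', a', b', α', β', hR₂, rfl⟩
  have reassoc : t α * star (t β) * (t α' * star (t β')) =
      t α * (star (t β) * t α') * star (t β') := by simp only [mul_assoc]
  rw [LinearMap.mul_apply', reassoc]
  have sandwich_le : Submodule.span ℂ {y | ∃ (f : Λ) (γ : f ⟶ e) (δ : f ⟶ e'),
      deg β + deg γ = deg β ⊔ deg α' ∧ deg α' + deg δ = deg β ⊔ deg α' ∧
        y = t γ * star (t δ)} ≤
      (mulStarSpan t R'').comap (LinearMap.mulLeftRight ℂ (t α, star (t β'))) := by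
    refine Submodule.span_le.2 ?_
    rintro _ ⟨f, γ, δ, hγ, hδ, rfl⟩
    have mem := mul_star_mem_mulStarSpan (t := t) (R := R'') (γ ≫ α) (δ ≫ β')
      (by rw [deg_comp, deg_comp]; exact hR _ _ _ _ _ _ hR₁ hR₂ hγ hδ)
    rw [ht.map_comp, ht.map_comp, star_mul] at mem
    simpa only [SetLike.mem_coe, Submodule.mem_comap, LinearMap.mulLeftRight_apply, mul_assoc]
      using mem
  exact sandwich_le (ht.star_mul_mem_span β α')

theorem star_mul_mem_gradedSpan_zero (ht : IsCuntzKriegerFamily t) {n : Fin k → ℤ} {y : A}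
    (hy : y ∈ gradedSpan t n) : star y * y ∈ gradedSpan t 0 := by
  have star_mem : star y ∈ mulStarSpan t fun p q => (fun i => (q i : ℤ) - p i) = n :=
    star_mem_mulStarSpan (fun _ _ => id) hy
  refine ht.mul_mem_mulStarSpan (R'' := fun p q => (fun i => (p i : ℤ) - q i) = 0)
    (fun p q p' q' r s h h' hr hs => funext fun i => ?_) star_mem hy
  have h := congrFun (h.trans h'.symm) i
  have hrs := congrFun (hr.trans hs.symm) i
  simp only [Pi.add_apply, Pi.zero_apply] at h hrs ⊢
  lia

theorem levelSpan_mono (ht : IsCuntzKriegerFamily t) : Monotone (levelSpan t) := by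
  refine fun m n hmn => mulStarSpan_le ?_
  rintro e a b α β ⟨hα, hβ⟩
  rw [ht.mul_star_eq_sum α β (n - m)]
  refine Submodule.sum_mem _ fun p hp => ?_
  have hp : deg p.2 = n - m := by rwa [Set.Finite.mem_toFinset, pathsInto, Set.mem_ofPred_eq] at hp
  refine mul_star_mem_mulStarSpan _ _ ?_
  rw [deg_comp, deg_comp, hα, hβ, hp, add_tsub_cancel_of_le hmn]
  exact ⟨rfl, rfl⟩

theorem exists_mem_levelSpan (ht : IsCuntzKriegerFamily t) {y : A} (hy : y ∈ gradedSpan t 0) :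
    ∃ m, y ∈ levelSpan t m :=
  (Submodule.mem_iSup_of_directed _ ht.levelSpan_mono.directed_le).1
    (gradedSpan_zero_le_iSup_levelSpan hy)

/-- The `*`-subalgebra underlying the level `m` of the core. -/
def levelSubalgebra (ht : IsCuntzKriegerFamily t) (m : Fin k → ℕ) :
    NonUnitalStarSubalgebra ℂ A where
  __ := levelSpan t m
  mul_mem' := ht.mul_mem_mulStarSpan (by
    rintro p q p' q' r s ⟨rfl, rfl⟩ ⟨rfl, rfl⟩ hr hs
    rw [sup_idem] at hr hs
    exact ⟨hr, hs⟩)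
  star_mem' := star_mem_mulStarSpan fun _ _ => And.symm

theorem star_mul_mul_mem_span_id (ht : IsCuntzKriegerFamily t) {m : Fin k → ℕ} {a b a' b' : Λ}
    (l : a ⟶ b) (l' : a' ⟶ b') (hl : deg l = m) (hl' : deg l' = m) {y : A}
    (hy : y ∈ levelSpan t m) : star (t l) * y * t l' ∈ Submodule.span ℂ {t (𝟙 a)} := by
  refine mulStarSpan_le (S := (Submodule.span ℂ {t (𝟙 a)}).comap
    (LinearMap.mulLeftRight ℂ (star (t l), t l'))) ?_ hy
  rintro e c d α β ⟨hα, hβ⟩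
  have reassoc : star (t l) * (t α * star (t β)) * t l' =
      star (t l) * t α * (star (t β) * t l') := by simp only [mul_assoc]
  rw [Submodule.mem_comap, LinearMap.mulLeftRight_apply, reassoc]
  rcases eq_or_ne (⟨a, b, l⟩ : Path Λ) ⟨e, c, α⟩ with h | h
  swap
  · rw [ht.star_mul_eq_zero_of_ne l α (hl.trans hα.symm) h, zero_mul]
    exact zero_mem _
  cases h
  rcases eq_or_ne (⟨a, d, β⟩ : Path Λ) ⟨a', b', l'⟩ with h | h
  swap
  · rw [ht.star_mul_eq_zero_of_ne β l' (hβ.trans hl'.symm) h, mul_zero]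
    exact zero_mem _
  cases h
  rw [ht.star_mul_self, ht.star_mul_self, ht.mul_id]
  exact Submodule.mem_span_singleton_self _

variable {B : Type*} [NonUnitalCStarAlgebra B]

theorem star_mul_mul_eq_zero_of_map_eq_zero (ht : IsCuntzKriegerFamily t) (φ : A →⋆ₙₐ[ℂ] B)
    (hφ : ∀ w : Λ, φ (t (𝟙 w)) ≠ 0) {m : Fin k → ℕ} {y : A}
    (hy : y ∈ closure (levelSpan t m : Set A)) (hφy : φ y = 0) {a b a' b' : Λ} (l : a ⟶ b)
    (l' : a' ⟶ b') (hl : deg l = m) (hl' : deg l' = m) : star (t l) * y * t l' = 0 := by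
  have mem_span : star (t l) * y * t l' ∈ Submodule.span ℂ {t (𝟙 a)} :=
    closure_minimal (fun z hz => ht.star_mul_mul_mem_span_id l l' hl hl' hz)
      ((Submodule.closed_of_finiteDimensional (Submodule.span ℂ {t (𝟙 a)})).preimage
        ((continuous_const_mul (star (t l))).mul_const (t l'))) hy
  obtain ⟨c, hc⟩ := Submodule.mem_span_singleton.1 mem_span
  have smul_eq_zero' : c • φ (t (𝟙 a)) = 0 := by
    rw [← map_smul, hc, map_mul, map_mul, hφy, mul_zero, zero_mul]
  rw [← hc, (smul_eq_zero.1 smul_eq_zero').resolve_right (hφ a), zero_smul]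

theorem eq_zero_of_mem_closure_levelSpan (ht : IsCuntzKriegerFamily t) (φ : A →⋆ₙₐ[ℂ] B)
    (hφ : ∀ w : Λ, φ (t (𝟙 w)) ≠ 0) {m : Fin k → ℕ} {y : A}
    (hy : y ∈ closure (levelSpan t m : Set A)) (hφy : φ y = 0) : y = 0 := by
  have sandwich : ∀ z ∈ levelSpan t m, ∀ z' ∈ levelSpan t m, z * y * z' = 0 := by
    intro z hz z' hz'
    refine (Submodule.mem_bot ℂ).1 (LinearMap.BilinMap.apply_apply_mem_of_mem_span ⊥ _ _
      ((LinearMap.mul ℂ A).comp (LinearMap.mulRight ℂ y)) ?_ z z' hz hz')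
    rintro _ ⟨e, a, b, α, β, ⟨-, hβ⟩, rfl⟩ _ ⟨e', a', b', α', β', ⟨hα', -⟩, rfl⟩
    have reassoc : t α * star (t β) * y * (t α' * star (t β')) =
        t α * (star (t β) * y * t α') * star (t β') := by simp only [mul_assoc]
    change t α * star (t β) * y * (t α' * star (t β')) = 0
    rw [reassoc, ht.star_mul_mul_eq_zero_of_map_eq_zero φ hφ hy hφy β α' hβ hα', mul_zero,
      zero_mul]
  have star_mem : star y ∈ closure (levelSpan t m : Set A) :=
    star_mem (s := (ht.levelSubalgebra m).topologicalClosure) hy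
  have star_mul_mul_star : star y * y * star y = 0 := by
    have hcont : Continuous fun z : A × A => z.1 * y * z.2 := by fun_prop
    simpa using map_mem_closure₂ (u := {0}) hcont star_mem star_mem sandwich
  rw [← CStarRing.star_mul_self_eq_zero_iff, ← CStarRing.star_mul_self_eq_zero_iff, star_mul,
    star_star, ← mul_assoc, star_mul_mul_star, zero_mul]

theorem norm_map_of_mem_closure_gradedSpan_zero (ht : IsCuntzKriegerFamily t) (φ : A →⋆ₙₐ[ℂ] B)
    (hφ : ∀ w : Λ, φ (t (𝟙 w)) ≠ 0) {y : A} (hy : y ∈ closure (gradedSpan t 0 : Set A)) :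
    ‖φ y‖ = ‖y‖ := by
  refine closure_minimal (fun z hz => ?_)
    (isClosed_eq (continuous_nonUnitalStarAlgHom φ).norm continuous_norm) hy
  obtain ⟨m, hm⟩ := ht.exists_mem_levelSpan hz
  let S := (ht.levelSubalgebra m).topologicalClosure
  have : IsClosed (S : Set A) := (ht.levelSubalgebra m).isClosed_topologicalClosure
  let ψ : S →⋆ₙₐ[ℂ] B := φ.comp (NonUnitalStarSubalgebraClass.subtype S)
  have hψ : Function.Injective ψ := (injective_iff_map_eq_zero ψ).2 fun w hw =>
    Subtype.ext (ht.eq_zero_of_mem_closure_levelSpan φ hφ w.2 hw)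
  exact NonUnitalStarAlgHom.norm_map ψ hψ ⟨z, subset_closure hm⟩

end IsCuntzKriegerFamily

end

end KGraph

/-! ### Fourier coefficients of vector-valued functions on the torus -/

section Fourier

open MeasureTheory UnitAddTorus

attribute [local instance] instMeasureSpaceUnitAddCircle

theorem isProbabilityMeasure_volume_unitAddCircle :
    IsProbabilityMeasure (volume : Measure UnitAddCircle) :=
  inferInstanceAs (IsProbabilityMeasure AddCircle.haarAddCircle)

attribute [local instance] isProbabilityMeasure_volume_unitAddCircle

variable {d : Type*} [Fintype d] {E : Type*} [NormedAddCommGroup E] [NormedSpace ℂ E]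

theorem norm_mFourier_apply {d : Type*} [Fintype d] (n : d → ℤ) (z : UnitAddTorus d) :
    ‖mFourier n z‖ = 1 := by
  simp only [mFourier, ContinuousMap.coe_mk, fourier_apply, norm_prod,
    Circle.norm_coe, Finset.prod_const_one]

theorem integrable_mFourier_smul {f : UnitAddTorus d → E} (hf : Continuous f) (n : d → ℤ) :
    Integrable fun z => mFourier n z • f z :=
  ((mFourier n).continuous.smul hf).integrable_of_hasCompactSupport (.of_compactSpace _)

theorem map_mFourierCoeff [CompleteSpace E] {G : Type*} [NormedAddCommGroup G] [NormedSpace ℂ G]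
    [CompleteSpace G] (L : E →L[ℂ] G) {f : UnitAddTorus d → E} (hf : Continuous f) (n : d → ℤ) :
    L (mFourierCoeff f n) = mFourierCoeff (fun z => L (f z)) n := by
  rw [mFourierCoeff, ← L.integral_comp_comm (integrable_mFourier_smul hf _)]
  simp only [map_smul]
  rfl

theorem mFourierCoeff_mFourier_smul [CompleteSpace E] [DecidableEq (d → ℤ)] (m n : d → ℤ) (y : E) :
    mFourierCoeff (fun z => mFourier m z • y) n = if m = n then y else 0 := by
  have orthogonality := orthonormal_iff_ite.1 (orthonormal_mFourier (d := d)) n m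
  simp only [ContinuousMap.inner_toLp, ← mFourier_neg, ← mFourier_add] at orthogonality
  have integrand_eq : ∀ z, mFourier (-n) z • mFourier m z • y = mFourier (m + -n) z • y := fun z =>
    by rw [smul_smul, ← mFourier_add, add_comm]
  rw [mFourierCoeff, integral_congr_ae (.of_forall integrand_eq), integral_smul_const,
    orthogonality]
  simp only [eq_comm (a := n), ite_smul, one_smul, zero_smul]

theorem eq_zero_of_forall_mFourierCoeff_eq_zero [CompleteSpace E] {f : UnitAddTorus d → E}
    (hf : Continuous f) (h : ∀ n, mFourierCoeff f n = 0) : f = 0 := by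
  refine funext fun z => SeparatingDual.eq_zero_of_forall_dual_eq_zero (R := ℂ) fun L => ?_
  let g : C(UnitAddTorus d, ℂ) := ⟨fun z => L (f z), L.continuous.comp hf⟩
  have coeff_eq_zero : mFourierCoeff g = 0 := funext fun n =>
    (map_mFourierCoeff L hf n).symm.trans (by rw [h, map_zero, Pi.zero_apply])
  have series := hasSum_mFourier_series_apply_of_summable (f := g)
    (coeff_eq_zero ▸ summable_zero) z
  simp only [coeff_eq_zero, Pi.zero_apply, zero_smul] at series
  exact series.unique hasSum_zero

theorem norm_mFourierCoeff_le {f : UnitAddTorus d → E} {C : ℝ} (h : ∀ z, ‖f z‖ ≤ C) (n : d → ℤ) :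
    ‖mFourierCoeff f n‖ ≤ C := by
  refine (norm_integral_le_of_norm_le_const (C := C) (.of_forall fun z => ?_)).trans_eq
    (by rw [probReal_univ, mul_one])
  rw [norm_smul, norm_mFourier_apply, one_mul]
  exact h z

end Fourier

/-! ### The gauge action on `C*(Λ)` -/

namespace KGraph

open UnitAddTorus

variable {k : ℕ} {Λ : Type u} [Category.{v} Λ] [KGraph k Λ]

/-- The character `z ↦ z^{d(l)}` of the torus attached to a path `l`, written additively: the torus
is `(ℝ/ℤ)^k`, as in `UnitAddTorus.mFourier`. -/
noncomputable def degChar {a b : Λ} (l : a ⟶ b) (z : UnitAddTorus (Fin k)) : ℂ :=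
  mFourier (fun i => (deg l i : ℤ)) z

theorem degChar_id (a : Λ) (z : UnitAddTorus (Fin k)) : degChar (𝟙 a) z = 1 := by
  simp only [degChar, deg_id, Pi.zero_apply, Nat.cast_zero]
  exact congrArg (· z) mFourier_zero

theorem degChar_comp {a b c : Λ} (ν : a ⟶ b) (μ : b ⟶ c) (z : UnitAddTorus (Fin k)) :
    degChar (ν ≫ μ) z = degChar μ z * degChar ν z := by
  rw [degChar, degChar, degChar, ← mFourier_add]
  simp only [deg_comp, Pi.add_apply, Nat.cast_add]
  rfl

theorem degChar_mul_star {a b c d : Λ} (l : a ⟶ b) (m : c ⟶ d) (z : UnitAddTorus (Fin k)) :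
    degChar l z * star (degChar m z) = mFourier (fun i => (deg l i : ℤ) - deg m i) z := by
  rw [degChar, degChar, RCLike.star_def, ← mFourier_neg, ← mFourier_add]
  rfl

theorem degChar_mul_star_self {a b : Λ} (l : a ⟶ b) (z : UnitAddTorus (Fin k)) :
    degChar l z * star (degChar l z) = 1 := by
  simp only [degChar_mul_star, sub_self]
  exact congrArg (· z) mFourier_zero

variable [RowFinite Λ]

theorem IsCuntzKriegerFamily.degChar_smul {A : Type*} [NonUnitalRing A] [StarRing A] [Module ℂ A]
    [IsScalarTower ℂ A A] [SMulCommClass ℂ A A] [StarModule ℂ A] {t : ∀ ⦃a b : Λ⦄, (a ⟶ b) → A}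
    (ht : IsCuntzKriegerFamily t) (z : UnitAddTorus (Fin k)) :
    IsCuntzKriegerFamily fun a b (l : a ⟶ b) => degChar l z • t l := by
  have star_mul_degChar : ∀ {a b : Λ} (l : a ⟶ b), star (degChar l z) * degChar l z = 1 :=
    fun l => (mul_comm _ _).trans (degChar_mul_star_self l z)
  intro x y h
  cases h with
  | partial_isometry l =>
    simp only [star_smul, smul_mul_smul_comm, ht.mul_star_mul, degChar_mul_star_self, one_mul]
  | vertex_star w => simp only [degChar_id, one_smul, ht.star_id]
  | vertex_idem w => simp only [degChar_id, one_smul, ht.mul_id]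
  | vertex_orth h => simp only [degChar_id, one_smul, ht.id_mul_id_of_ne h]
  | mul ν μ => simp only [smul_mul_smul_comm, ht.map_comp, degChar_comp]
  | star_mul l =>
    simp only [star_smul, smul_mul_smul_comm, ht.star_mul_self, degChar_id, one_smul,
      star_mul_degChar]
  | sum w n =>
    simp only [star_smul, smul_mul_smul_comm, degChar_id, one_smul, degChar_mul_star_self]
    exact ht.id_eq_sum w n

variable (Λ) in
/-- The `*`-subalgebra of `C*(Λ)` consisting of the linear combinations of the products
`t_α t_β*`. -/
noncomputable def mulStarSubalgebra : NonUnitalStarSubalgebra ℂ (CStar Λ) where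
  __ := mulStarSpan (univ (Λ := Λ)) fun _ _ => True
  mul_mem' := isCuntzKriegerFamily_univ.mul_mem_mulStarSpan fun _ _ _ _ _ _ _ _ _ _ => trivial
  star_mem' := star_mem_mulStarSpan fun _ _ => id

theorem univ_mem_mulStarSubalgebra {a b : Λ} (l : a ⟶ b) : univ l ∈ mulStarSubalgebra Λ := by
  have ht := isCuntzKriegerFamily_univ (Λ := Λ)
  rw [← ht.mul_id l, ← ht.star_id]
  exact mul_star_mem_mulStarSpan (t := univ) (R := fun _ _ => True) l (𝟙 a) trivial

variable (Λ) in
theorem dense_mulStarSubalgebra : Dense (mulStarSubalgebra Λ : Set (CStar Λ)) := by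
  refine (CStarSeminorm.Envelope.denseRange_ι (N := ckSeminorm Λ)).mono ?_
  rintro _ ⟨f, rfl⟩
  obtain ⟨ψ, hψ⟩ := FreeStarAlg.exists_lift fun p : Path Λ =>
    (⟨univ p.2.2, univ_mem_mulStarSubalgebra p.2.2⟩ : mulStarSubalgebra Λ)
  have factor : (NonUnitalStarSubalgebraClass.subtype (mulStarSubalgebra Λ)).comp ψ =
      CStarSeminorm.Envelope.ιHom (ckSeminorm Λ) :=
    FreeStarAlg.hom_ext fun p => congrArg Subtype.val (hψ p)
  have hf : (ψ f : CStar Λ) = CStarSeminorm.Envelope.ι f := DFunLike.congr_fun factor f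
  exact hf ▸ (ψ f).2

/-- The gauge action of the torus on `C*(Λ)`. -/
noncomputable def gauge (z : UnitAddTorus (Fin k)) : CStar Λ →⋆ₙₐ[ℂ] CStar Λ :=
  (existsUnique_lift _ (isCuntzKriegerFamily_univ.degChar_smul z)).choose

theorem gauge_univ (z : UnitAddTorus (Fin k)) {a b : Λ} (l : a ⟶ b) :
    gauge z (univ l) = degChar l z • univ l :=
  (existsUnique_lift _ (isCuntzKriegerFamily_univ.degChar_smul z)).choose_spec.1 l

theorem gauge_zero : gauge (0 : UnitAddTorus (Fin k)) = NonUnitalStarAlgHom.id ℂ (CStar Λ) := by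
  refine (existsUnique_lift _ isCuntzKriegerFamily_univ).unique (fun a b l => ?_) fun _ _ _ => rfl
  rw [gauge_univ, degChar]
  simp [mFourier]

theorem gauge_mul_star (z : UnitAddTorus (Fin k)) {e a b : Λ} (α : e ⟶ a) (β : e ⟶ b) :
    gauge z (univ α * star (univ β)) =
      mFourier (fun i => (deg α i : ℤ) - deg β i) z • (univ α * star (univ β)) := by
  rw [map_mul, map_star, gauge_univ, gauge_univ, star_smul, smul_mul_smul_comm, degChar_mul_star]

theorem continuous_gauge_of_mem_mulStarSubalgebra {y : CStar Λ} (hy : y ∈ mulStarSubalgebra Λ) :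
    Continuous fun z : UnitAddTorus (Fin k) => gauge z y := by
  induction hy using Submodule.span_induction with
  | zero => simp only [map_zero]; exact continuous_const
  | add y y' _ _ h h' => simp only [map_add]; exact h.add h'
  | smul c y _ h => simp only [map_smul]; exact h.const_smul c
  | mem y hy =>
    obtain ⟨e, a, b, α, β, -, rfl⟩ := hy
    simp only [gauge_mul_star]
    exact (mFourier _).continuous.smul continuous_const

theorem continuous_gauge (y : CStar Λ) :
    Continuous fun z : UnitAddTorus (Fin k) => gauge z y := by
  refine continuous_of_uniform_approx_of_continuous fun U hU => ?_
  obtain ⟨ε, hε, hU⟩ := Metric.mem_uniformity_dist.1 hU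
  obtain ⟨y', hy', hmem⟩ := Metric.dense_iff.1 (dense_mulStarSubalgebra Λ) y ε hε
  refine ⟨_, continuous_gauge_of_mem_mulStarSubalgebra hmem, fun z => hU ?_⟩
  calc dist (gauge z y) (gauge z y') = ‖gauge z (y - y')‖ := by rw [dist_eq_norm, map_sub]
    _ ≤ ‖y - y'‖ := NonUnitalStarAlgHom.norm_apply_le _ _
    _ < ε := by rwa [← dist_eq_norm, dist_comm]

/-- The projection of `C*(Λ)` onto the spectral subspace of degree `n` of the gauge action: the
`n`-th Fourier coefficient of the orbit map. -/
noncomputable def spectralPart (n : Fin k → ℤ) : CStar Λ →L[ℂ] CStar Λ :=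
  LinearMap.mkContinuous
    { toFun := fun y => mFourierCoeff (fun z => gauge z y) n
      map_add' := fun y y' => by
        simp only [mFourierCoeff, map_add, smul_add]
        exact MeasureTheory.integral_add (integrable_mFourier_smul (continuous_gauge y) _)
          (integrable_mFourier_smul (continuous_gauge y') _)
      map_smul' := fun c y => by
        simp only [mFourierCoeff, map_smul, RingHom.id_apply]
        rw [← MeasureTheory.integral_smul]
        simp only [smul_comm c] } 1
    fun y => by
      rw [one_mul]
      exact norm_mFourierCoeff_le (fun z => NonUnitalStarAlgHom.norm_apply_le _ _) n

theorem spectralPart_apply (n : Fin k → ℤ) (y : CStar Λ) :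
    spectralPart n y = mFourierCoeff (fun z => gauge z y) n := rfl

theorem spectralPart_mem_closure_gradedSpan (n : Fin k → ℤ) (y : CStar Λ) :
    spectralPart n y ∈ closure (gradedSpan (univ (Λ := Λ)) n : Set (CStar Λ)) := by
  have maps_span : mulStarSpan (univ (Λ := Λ)) (fun _ _ => True) ≤
      (gradedSpan (univ (Λ := Λ)) n).comap (spectralPart n).toLinearMap := by
    refine mulStarSpan_le fun α β _ => ?_
    change spectralPart n (univ α * star (univ β)) ∈ gradedSpan (univ (Λ := Λ)) n
    simp only [spectralPart_apply, gauge_mul_star, mFourierCoeff_mFourier_smul]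
    split_ifs with h
    · exact mul_star_mem_mulStarSpan α β h
    · exact zero_mem _
  exact map_mem_closure (spectralPart n).continuous (dense_mulStarSubalgebra Λ y)
    fun _ hz => maps_span hz

theorem eq_zero_of_forall_spectralPart_eq_zero {y : CStar Λ}
    (h : ∀ n : Fin k → ℤ, spectralPart n y = 0) : y = 0 := by
  have orbit_eq_zero := congrFun
    (eq_zero_of_forall_mFourierCoeff_eq_zero (continuous_gauge y) h) 0
  rwa [gauge_zero] at orbit_eq_zero

theorem injective_of_gauge_mem_ker {B : Type*} [NonUnitalCStarAlgebra B] (φ : CStar Λ →⋆ₙₐ[ℂ] B)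
    (hφ : ∀ w : Λ, φ (univ (𝟙 w)) ≠ 0)
    (hker : ∀ (z : UnitAddTorus (Fin k)) (y : CStar Λ), φ y = 0 → φ (gauge z y) = 0) :
    Function.Injective φ := by
  have ht := isCuntzKriegerFamily_univ (Λ := Λ)
  refine (injective_iff_map_eq_zero φ).2 fun y hy =>
    eq_zero_of_forall_spectralPart_eq_zero fun n => ?_
  have map_spectralPart : φ (spectralPart n y) = 0 := by
    let Φ : CStar Λ →L[ℂ] B := ⟨φ, continuous_nonUnitalStarAlgHom φ⟩
    have map_orbit : ∀ z, Φ (gauge z y) = 0 := fun z => hker z y hy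
    refine (map_mFourierCoeff Φ (continuous_gauge y) n).trans ?_
    simp only [map_orbit, mFourierCoeff, smul_zero, MeasureTheory.integral_zero]
  have star_mul_mem : star (spectralPart n y) * spectralPart n y ∈
      closure (gradedSpan (univ (Λ := Λ)) 0 : Set (CStar Λ)) :=
    map_mem_closure (f := fun z : CStar Λ => star z * z) (by fun_prop)
      (spectralPart_mem_closure_gradedSpan n y) fun _ hz => ht.star_mul_mem_gradedSpan_zero hz
  rw [← CStarRing.star_mul_self_eq_zero_iff, ← norm_eq_zero,
    ← ht.norm_map_of_mem_closure_gradedSpan_zero φ hφ star_mul_mem, map_mul, map_spectralPart,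
    mul_zero, norm_zero]

end KGraph

/-! ### Operators between orthonormal families -/

section OrthonormalTransfer

variable {𝕜 ι E F : Type*} [RCLike 𝕜] [NormedAddCommGroup E] [InnerProductSpace 𝕜 E]
  [NormedAddCommGroup F] [InnerProductSpace 𝕜 F] {v : ι → E} {w : ι → F}

theorem orthonormal_smul_of_norm_eq_one (hv : Orthonormal 𝕜 v) {c : ι → 𝕜} (hc : ∀ i, ‖c i‖ = 1) :
    Orthonormal 𝕜 fun i => c i • v i :=
  ⟨fun i => by rw [norm_smul, hc, hv.1, one_mul], fun i j hij => by
    simp only [inner_smul_left, inner_smul_right, hv.2 hij, mul_zero]⟩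

variable [CompleteSpace E] [CompleteSpace F]

theorem linearIsometry_lpSingle_one [DecidableEq ι] (hv : Orthonormal 𝕜 v) (i : ι) :
    hv.orthogonalFamily.linearIsometry (lp.single 2 i 1) = v i := by
  rw [OrthogonalFamily.linearIsometry_apply_single, LinearIsometry.toSpanSingleton_apply, one_smul]

/-- The partial isometry that maps `v i` to `w i` and vanishes on the orthogonal complement of the
family `v`: it factors through `ℓ²(ι)`. -/
noncomputable def orthonormalTransfer (hv : Orthonormal 𝕜 v) (hw : Orthonormal 𝕜 w) : E →L[𝕜] F :=
  hw.orthogonalFamily.linearIsometry.toContinuousLinearMap ∘L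
    ContinuousLinearMap.adjoint hv.orthogonalFamily.linearIsometry.toContinuousLinearMap

theorem orthonormalTransfer_apply_self (hv : Orthonormal 𝕜 v) (hw : Orthonormal 𝕜 w) (i : ι) :
    orthonormalTransfer hv hw (v i) = w i := by
  classical
  have adjoint_apply := DFunLike.congr_fun
    hv.orthogonalFamily.linearIsometry.adjoint_comp_self (lp.single 2 i 1)
  rw [ContinuousLinearMap.comp_apply, LinearIsometry.coe_toContinuousLinearMap,
    linearIsometry_lpSingle_one hv] at adjoint_apply
  rw [orthonormalTransfer, ContinuousLinearMap.comp_apply, adjoint_apply]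
  exact linearIsometry_lpSingle_one hw i

theorem orthonormalTransfer_eq_zero (hv : Orthonormal 𝕜 v) (hw : Orthonormal 𝕜 w) {y : E}
    (hy : ∀ i, inner 𝕜 (v i) y = 0) : orthonormalTransfer hv hw y = 0 := by
  classical
  suffices ContinuousLinearMap.adjoint
      hv.orthogonalFamily.linearIsometry.toContinuousLinearMap y = 0 by
    rw [orthonormalTransfer, ContinuousLinearMap.comp_apply, this, map_zero]
  ext i
  have coordinate := lp.inner_single_left (𝕜 := 𝕜) (G := fun _ : ι => 𝕜) i 1
    (ContinuousLinearMap.adjoint hv.orthogonalFamily.linearIsometry.toContinuousLinearMap y)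
  rw [ContinuousLinearMap.adjoint_inner_right, LinearIsometry.coe_toContinuousLinearMap,
    linearIsometry_lpSingle_one hv, hy] at coordinate
  simpa using coordinate.symm

theorem adjoint_orthonormalTransfer (hv : Orthonormal 𝕜 v) (hw : Orthonormal 𝕜 w) :
    ContinuousLinearMap.adjoint (orthonormalTransfer hv hw) = orthonormalTransfer hw hv := by
  rw [orthonormalTransfer, ContinuousLinearMap.adjoint_comp, ContinuousLinearMap.adjoint_adjoint,
    orthonormalTransfer]

end OrthonormalTransfer

namespace HilbertLimit

variable {I : Type*} [Preorder I] [IsDirectedOrder I] {E : I → Type*}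
  [∀ i, NormedAddCommGroup (E i)] [∀ i, InnerProductSpace ℂ (E i)]
  (f : ∀ i j, i ≤ j → E i →ₗᵢ[ℂ] E j) [DirectedSystem E (f · · ·)] [Nonempty I]

theorem inner_mk (i : I) (a b : E i) : inner ℂ (mk f i a) (mk f i b) = inner ℂ a b := by
  rw [mk, mk, UniformSpace.Completion.inner_coe]
  exact AlgLimit.inner_mk f i a b

theorem mk_map {i j : I} (h : i ≤ j) (a : E i) : mk f j (f i j h a) = mk f i a :=
  congrArg _ (AlgLimit.mk_map f h a)

/-- The canonical isometry of the `i`-th space into the inductive limit. -/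
noncomputable def mkₗᵢ (i : I) : E i →ₗᵢ[ℂ] HilbertLimit f :=
  LinearMap.isometryOfInner
    { toFun := mk f i
      map_add' := fun a b => by
        rw [mk, AlgLimit.mk_add, UniformSpace.Completion.coe_add]; rfl
      map_smul' := fun c a => by
        rw [mk, AlgLimit.mk_smul, UniformSpace.Completion.coe_smul]; rfl }
    (inner_mk f i)

theorem clm_ext {G : Type*} [TopologicalSpace G] [AddCommMonoid G] [Module ℂ G] [T2Space G]
    {S T : HilbertLimit f →L[ℂ] G} (h : ∀ i a, S (mk f i a) = T (mk f i a)) : S = T := by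
  ext y
  refine UniformSpace.Completion.induction_on y (isClosed_eq S.continuous T.continuous) fun y => ?_
  exact AlgLimit.ind f (P := fun y => S (UniformSpace.Completion.coe' y) =
    T (UniformSpace.Completion.coe' y)) h y

end HilbertLimit

namespace KGraph

section Factorization

variable {k : ℕ} {Λ : Type u} [Category.{v} Λ] [KGraph k Λ]

theorem factorization_unique {a b b' c : Λ} {f : a ⟶ b} {l : b ⟶ c} {f' : a ⟶ b'} {l' : b' ⟶ c}
    (h : f ≫ l = f' ≫ l') (hd : deg l = deg l') :
    (⟨b, f, l⟩ : Σ b : Λ, (a ⟶ b) × (b ⟶ c)) = ⟨b', f', l'⟩ := by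
  have hd' : deg f = deg f' := by
    have deg_eq := congrArg deg h
    rw [deg_comp, deg_comp, hd] at deg_eq
    exact add_left_cancel deg_eq
  exact (KGraph.factorization (f ≫ l) (deg l) (deg f) (deg_comp _ _)).unique ⟨rfl, rfl, rfl⟩
    ⟨hd.symm, hd'.symm, h.symm⟩

end Factorization

namespace InfinitePath

variable {k : ℕ} {Λ : Type u} [Category.{v} Λ] [KGraph k Λ] (x : InfinitePath Λ) {a b c w : Λ}

/-! ### Germs of paths along an infinite path -/

theorem deg_segment {i j : ℕ} (h : i ≤ j) (c : Fin k) : deg (x.segment h) c = j - i :=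
  congrFun (x.deg_map (q := diag k j) (p := diag k i) ⟨fun _ => h⟩) c

/-- The restriction of `x.append h` to the paths of range `w`. -/
def appendSegment (w : Λ) {i j : ℕ} (h : i ≤ j) : (x.vertex i ⟶ w) ↪ (x.vertex j ⟶ w) where
  toFun μ := x.segment h ≫ μ
  inj' μ μ' heq := by
    have append_eq : x.append h ⟨w, μ⟩ = x.append h ⟨w, μ'⟩ := congrArg (Sigma.mk w) heq
    simpa using x.append_injective h append_eq

theorem appendSegment_apply {i j : ℕ} (h : i ≤ j) (μ : x.vertex i ⟶ w) :
    x.appendSegment w h μ = x.segment h ≫ μ := rfl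

instance (w : Λ) : DirectedSystem (fun i => x.vertex i ⟶ w) fun _ _ h => x.appendSegment w h where
  map_self i μ := by
    rw [appendSegment_apply, segment_self, Category.id_comp]
  map_map l j i hij hjl μ := by
    simp only [appendSegment_apply, ← Category.assoc, segment_comp]

/-- The germs of range `w`: paths `μ : v_i ⟶ w`, where `μ` is identified with `μ x_i ⋯ x_{j-1}` for
all `j ≥ i`. They index the canonical orthonormal basis of `H_x`. -/
def Germ (w : Λ) : Type v :=
  DirectLimit (fun i => x.vertex i ⟶ w) fun _ _ h => x.appendSegment w h

/-- The germ of a path whose source lies on `x`. -/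
def germ (i : ℕ) (μ : x.vertex i ⟶ w) : x.Germ w := ⟦⟨i, μ⟩⟧

variable {x}

theorem exists_germ_eq (g : x.Germ w) : ∃ i μ, x.germ i μ = g :=
  let ⟨i, μ, h⟩ := DirectLimit.exists_eq_mk _ g
  ⟨i, μ, h.symm⟩

theorem germ_segment {i j : ℕ} (h : i ≤ j) (μ : x.vertex i ⟶ w) :
    x.germ j (x.segment h ≫ μ) = x.germ i μ :=
  (DirectLimit.eq_of_le (f := fun _ _ h => x.appendSegment w h)
    (⟨i, μ⟩ : Σ i, x.vertex i ⟶ w) j h).symm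

theorem exists_germ_eq₂ (g : x.Germ a) (h : x.Germ b) :
    ∃ i μ ν, x.germ i μ = g ∧ x.germ i ν = h := by
  obtain ⟨i, μ, rfl⟩ := exists_germ_eq g
  obtain ⟨j, ν, rfl⟩ := exists_germ_eq h
  exact ⟨max i j, _, _, germ_segment (le_max_left i j) μ, germ_segment (le_max_right i j) ν⟩

theorem germ_injective (i : ℕ) : Function.Injective (x.germ (w := w) i) :=
  DirectLimit.mk_injective (fun _ _ h => x.appendSegment w h)
    (fun _ _ h => (x.appendSegment w h).injective) i

namespace Germ

/-- The germ `λg` obtained by prefixing a path `λ` to a germ `g`, with `λ` on the right as in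
`CategoryStruct.comp`. -/
def comp (g : x.Germ a) (l : a ⟶ b) : x.Germ b :=
  DirectLimit.map _ _ (fun _ μ => μ ≫ l) (fun _ _ _ _ => (Category.assoc _ _ _).symm) g

theorem germ_comp (i : ℕ) (μ : x.vertex i ⟶ a) (l : a ⟶ b) :
    (x.germ i μ).comp l = x.germ i (μ ≫ l) := rfl

theorem comp_id (g : x.Germ a) : g.comp (𝟙 a) = g := by
  obtain ⟨i, μ, rfl⟩ := exists_germ_eq g
  rw [germ_comp, Category.comp_id]

theorem comp_comp (g : x.Germ a) (l : a ⟶ b) (m : b ⟶ c) :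
    (g.comp l).comp m = g.comp (l ≫ m) := by
  obtain ⟨i, μ, rfl⟩ := exists_germ_eq g
  rw [germ_comp, germ_comp, germ_comp, Category.assoc]

/-- The degree `d(μ) - (i, …, i)` of the germ of a path `μ` with source `v_i`. -/
def deg (g : x.Germ w) : Fin k → ℤ :=
  DirectLimit.lift _ (fun i (μ : x.vertex i ⟶ w) c => (KGraph.deg μ c : ℤ) - i)
    (fun i j h μ => by
      funext c
      rw [appendSegment_apply, KGraph.deg_comp, Pi.add_apply, deg_segment]
      omega) g

theorem deg_comp (g : x.Germ a) (l : a ⟶ b) :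
    (g.comp l).deg = (fun i => (KGraph.deg l i : ℤ)) + g.deg := by
  obtain ⟨i, μ, rfl⟩ := exists_germ_eq g
  funext j
  change (KGraph.deg (μ ≫ l) j : ℤ) - i = KGraph.deg l j + (KGraph.deg μ j - i)
  rw [KGraph.deg_comp, Pi.add_apply]
  omega

/-- Appending a segment of `x` makes a representative of the germ long enough to split off a path of
degree `n`. -/
theorem exists_eq_comp (n : Fin k → ℕ) (g : x.Germ w) :
    ∃ (a : Λ) (l : a ⟶ w) (h : x.Germ a), KGraph.deg l = n ∧ h.comp l = g := by
  obtain ⟨i, μ, rfl⟩ := exists_germ_eq g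
  have hle : i ≤ i + ∑ c, n c := Nat.le_add_right _ _
  have n_le : n ≤ KGraph.deg (x.segment hle ≫ μ) := fun c => by
    rw [KGraph.deg_comp, Pi.add_apply, deg_segment, Nat.add_sub_cancel_left]
    exact (Finset.single_le_sum (fun _ _ => Nat.zero_le _) (Finset.mem_univ c)).trans
      (Nat.le_add_left _ _)
  obtain ⟨⟨a, ν, l⟩, ⟨hl, -, h⟩, -⟩ := KGraph.factorization (x.segment hle ≫ μ) n _
    (add_tsub_cancel_of_le n_le).symm
  exact ⟨a, l, x.germ _ ν, hl, by rw [germ_comp, h, germ_segment]⟩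

theorem eq_of_comp_eq_comp {a' : Λ} {g : x.Germ a} {g' : x.Germ a'} {l : a ⟶ b} {l' : a' ⟶ b}
    (h : g.comp l = g'.comp l') (hd : KGraph.deg l = KGraph.deg l') :
    (⟨a, g, l⟩ : Σ a, x.Germ a × (a ⟶ b)) = ⟨a', g', l'⟩ := by
  obtain ⟨i, μ, μ', rfl, rfl⟩ := exists_germ_eq₂ g g'
  cases factorization_unique (germ_injective i h) hd
  rfl

theorem comp_injective (l : a ⟶ b) : Function.Injective fun g : x.Germ a => g.comp l :=
  fun g g' h => by simpa using eq_of_comp_eq_comp h rfl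

end Germ

variable (x)

/-! ### The canonical orthonormal basis of `H_x` -/

theorem ξ_segment {i j : ℕ} (h : i ≤ j) (μ : x.vertex i ⟶ w) :
    x.ξ j (x.segment h ≫ μ) = x.ξ i μ := by
  rw [ξ, ξ, ← HilbertLimit.mk_map x.trans h (x.basisVec i ⟨w, μ⟩), trans_basisVec]
  rfl

theorem orthonormal_ξ (i : ℕ) : Orthonormal ℂ fun μ : x.F i => x.ξ i μ.2 := by
  have orthonormal_basisVec := x.orthonormal_append (le_refl i)
  simp only [append, segment_self, Category.id_comp] at orthonormal_basisVec
  exact orthonormal_basisVec.comp_linearIsometry (HilbertLimit.mkₗᵢ x.trans i)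

/-- The basis vector of `H_x` attached to a germ: `[ξ^i_μ]` for the germ of `μ`. -/
noncomputable def germVec (g : x.Germ w) : x.H :=
  DirectLimit.lift (fun _ _ h => x.appendSegment w h) (fun i μ => x.ξ i μ)
    (fun i j h μ => by rw [appendSegment_apply, ξ_segment]) g

variable {x}

theorem orthonormal_germVec : Orthonormal ℂ fun g : Σ w, x.Germ w => x.germVec g.2 := by
  refine ⟨fun ⟨w, g⟩ => ?_, fun ⟨w, g⟩ ⟨w', g'⟩ hne => ?_⟩
  · obtain ⟨i, μ, rfl⟩ := exists_germ_eq g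
    exact (x.orthonormal_ξ i).1 ⟨w, μ⟩
  · obtain ⟨i, μ, μ', rfl, rfl⟩ := exists_germ_eq₂ g g'
    exact (x.orthonormal_ξ i).2 (i := ⟨w, μ⟩) (j := ⟨w', μ'⟩) fun h => hne (by cases h; rfl)

theorem clm_ext_germVec {G : Type*} [NormedAddCommGroup G] [NormedSpace ℂ G] {S T : x.H →L[ℂ] G}
    (h : ∀ w (g : x.Germ w), S (x.germVec g) = T (x.germVec g)) : S = T := by
  refine HilbertLimit.clm_ext x.trans fun i a => ?_
  have eq_on_level : S ∘L (HilbertLimit.mkₗᵢ x.trans i).toContinuousLinearMap =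
      T ∘L (HilbertLimit.mkₗᵢ x.trans i).toContinuousLinearMap :=
    x.ext_basisVec fun μ => h μ.1 (x.germ i μ.2)
  exact DFunLike.congr_fun eq_on_level a

variable (x) in
theorem topologicalClosure_span_germVec :
    (Submodule.span ℂ (Set.range fun g : Σ w, x.Germ w => x.germVec g.2)).topologicalClosure =
      ⊤ := by
  rw [Submodule.topologicalClosure_eq_top_iff, Submodule.eq_bot_iff]
  intro y hy
  have inner_eq_zero : innerSL ℂ y = 0 := clm_ext_germVec fun w g =>
    Submodule.inner_left_of_mem_orthogonal
      (Submodule.subset_span (Set.mem_range_self (⟨w, g⟩ : Σ w, x.Germ w))) hy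
  exact inner_self_eq_zero.1 (DFunLike.congr_fun inner_eq_zero y)

instance (w : Λ) : Countable (x.Germ w) :=
  have := fun i => CountableCategory.countableHom (x.vertex i) w
  inferInstanceAs (Countable (Quotient _))

variable (x) in
theorem separableSpace_H : TopologicalSpace.SeparableSpace x.H := by
  have : Countable Λ := CountableCategory.countableObj
  have isSeparable_closure := (Set.countable_range
    fun g : Σ w, x.Germ w => x.germVec g.2).isSeparable.span (R := ℂ) |>.closure
  rw [← Submodule.topologicalClosure_coe, topologicalClosure_span_germVec] at isSeparable_closure
  exact TopologicalSpace.isSeparable_univ_iff.1 isSeparable_closure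

/-! ### The prefixing operators -/

theorem orthonormal_germVec_comp (l : a ⟶ b) :
    Orthonormal ℂ fun g : x.Germ a => x.germVec (g.comp l) :=
  orthonormal_germVec.comp (fun g : x.Germ a => (⟨b, g.comp l⟩ : Σ w, x.Germ w))
    (sigma_mk_injective.comp (Germ.comp_injective l))

variable (x) in
/-- The operator `T_λ` on `H_x` that prefixes the path `λ`. -/
noncomputable def prefixOp ⦃a b : Λ⦄ (l : a ⟶ b) : x.H →L[ℂ] x.H :=
  orthonormalTransfer (orthonormal_germVec.comp (Sigma.mk a) sigma_mk_injective)
    (orthonormal_germVec_comp l)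

theorem prefixOp_germVec (l : a ⟶ b) (g : x.Germ a) :
    x.prefixOp l (x.germVec g) = x.germVec (g.comp l) :=
  orthonormalTransfer_apply_self (orthonormal_germVec.comp (Sigma.mk a) sigma_mk_injective) _ g

theorem prefixOp_germVec_of_ne (l : a ⟶ b) (hw : w ≠ a) (g : x.Germ w) :
    x.prefixOp l (x.germVec g) = 0 :=
  orthonormalTransfer_eq_zero _ _ fun g' =>
    orthonormal_germVec.2 (i := ⟨a, g'⟩) (j := ⟨w, g⟩) fun h => hw (congrArg Sigma.fst h).symm

theorem star_prefixOp_germVec_comp (l : a ⟶ b) (g : x.Germ a) :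
    star (x.prefixOp l) (x.germVec (g.comp l)) = x.germVec g := by
  rw [ContinuousLinearMap.star_eq_adjoint, prefixOp, adjoint_orthonormalTransfer]
  exact orthonormalTransfer_apply_self (orthonormal_germVec_comp l) _ g

theorem star_prefixOp_germVec_of_ne (l : a ⟶ b) {g : x.Germ w}
    (h : ∀ g' : x.Germ a, (⟨b, g'.comp l⟩ : Σ w, x.Germ w) ≠ ⟨w, g⟩) :
    star (x.prefixOp l) (x.germVec g) = 0 := by
  rw [ContinuousLinearMap.star_eq_adjoint, prefixOp, adjoint_orthonormalTransfer]
  exact orthonormalTransfer_eq_zero _ _ fun g' =>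
    orthonormal_germVec.2 (i := ⟨b, g'.comp l⟩) (j := ⟨w, g⟩) (h g')

variable (x) in
theorem isPrefixing_prefixOp : x.IsPrefixing x.prefixOp :=
  ⟨fun _ _ l i μ => prefixOp_germVec l (x.germ i μ),
    fun _ _ l i _ μ hw => prefixOp_germVec_of_ne l hw (x.germ i μ)⟩

theorem IsPrefixing.eq_prefixOp {T : ∀ ⦃a b : Λ⦄, (a ⟶ b) → (x.H →L[ℂ] x.H)}
    (hT : x.IsPrefixing T) : T = x.prefixOp := by
  funext a b l
  refine clm_ext_germVec fun w g => ?_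
  obtain ⟨i, μ, rfl⟩ := exists_germ_eq g
  obtain rfl | hw := eq_or_ne w a
  · exact (hT.1 l i μ).trans (prefixOp_germVec l (x.germ i μ)).symm
  · exact (hT.2 l i w μ hw).trans (prefixOp_germVec_of_ne l hw (x.germ i μ)).symm

theorem prefixOp_id_germVec (g : x.Germ a) : x.prefixOp (𝟙 a) (x.germVec g) = x.germVec g := by
  rw [prefixOp_germVec, Germ.comp_id]

theorem prefixOp_id_ne_zero {i : ℕ} (μ : x.vertex i ⟶ w) : x.prefixOp (𝟙 w) ≠ 0 := by
  intro h
  have germVec_eq_zero := prefixOp_id_germVec (x.germ i μ)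
  rw [h, zero_apply] at germVec_eq_zero
  exact orthonormal_germVec.ne_zero ⟨w, x.germ i μ⟩ germVec_eq_zero.symm

theorem prefixOp_mul_prefixOp (l : a ⟶ b) (m : b ⟶ c) :
    x.prefixOp m * x.prefixOp l = x.prefixOp (l ≫ m) := by
  refine clm_ext_germVec fun w g => ?_
  rw [mul_apply_eq_comp]
  obtain rfl | hw := eq_or_ne w a
  · rw [prefixOp_germVec, prefixOp_germVec, prefixOp_germVec, Germ.comp_comp]
  · rw [prefixOp_germVec_of_ne l hw, prefixOp_germVec_of_ne _ hw, map_zero]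

theorem star_prefixOp_mul_self (l : a ⟶ b) :
    star (x.prefixOp l) * x.prefixOp l = x.prefixOp (𝟙 a) := by
  refine clm_ext_germVec fun w g => ?_
  rw [mul_apply_eq_comp]
  obtain rfl | hw := eq_or_ne w a
  · rw [prefixOp_germVec, star_prefixOp_germVec_comp, prefixOp_id_germVec]
  · rw [prefixOp_germVec_of_ne l hw, prefixOp_germVec_of_ne _ hw, map_zero]

theorem prefixOp_id_mul_prefixOp_id_of_ne (h : a ≠ b) :
    x.prefixOp (𝟙 a) * x.prefixOp (𝟙 b) = 0 := by
  refine clm_ext_germVec fun w g => ?_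
  rw [mul_apply_eq_comp, zero_apply]
  obtain rfl | hw := eq_or_ne w b
  · rw [prefixOp_id_germVec, prefixOp_germVec_of_ne _ h.symm]
  · rw [prefixOp_germVec_of_ne _ hw, map_zero]

theorem prefixOp_mul_star_germVec_comp (l : a ⟶ b) (g : x.Germ a) :
    (x.prefixOp l * star (x.prefixOp l)) (x.germVec (g.comp l)) = x.germVec (g.comp l) := by
  rw [mul_apply_eq_comp, star_prefixOp_germVec_comp, prefixOp_germVec]

theorem prefixOp_mul_star_germVec_of_ne (l : a ⟶ b) {g : x.Germ w}
    (h : ∀ g' : x.Germ a, (⟨b, g'.comp l⟩ : Σ w, x.Germ w) ≠ ⟨w, g⟩) :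
    (x.prefixOp l * star (x.prefixOp l)) (x.germVec g) = 0 := by
  rw [mul_apply_eq_comp, star_prefixOp_germVec_of_ne l h, map_zero]

section CuntzKrieger

variable [RowFinite Λ]

theorem prefixOp_id_eq_sum (w : Λ) (n : Fin k → ℕ) :
    x.prefixOp (𝟙 w) = ∑ p ∈ (RowFinite.finite_pathsInto w n).toFinset,
      x.prefixOp p.2 * star (x.prefixOp p.2) := by
  refine clm_ext_germVec fun w' g => ?_
  rw [sum_apply]
  obtain rfl | hw := eq_or_ne w' w
  · obtain ⟨a, l, g, hl, rfl⟩ := g.exists_eq_comp n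
    rw [prefixOp_id_germVec, Finset.sum_eq_single ⟨a, l⟩,
      prefixOp_mul_star_germVec_comp]
    · rintro ⟨a', l'⟩ hl' hne
      refine prefixOp_mul_star_germVec_of_ne l' fun g' h => hne ?_
      have hl' : deg l' = n := by simpa [pathsInto] using hl'
      cases Germ.eq_of_comp_eq_comp (sigma_mk_injective h) (hl'.trans hl.symm)
      rfl
    · intro hmem
      exact absurd (by simpa [pathsInto] using hl) hmem
  · rw [prefixOp_germVec_of_ne _ hw]
    exact (Finset.sum_eq_zero fun p _ => prefixOp_mul_star_germVec_of_ne p.2 fun g' h =>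
      hw (congrArg Sigma.fst h).symm).symm

variable (x) in
theorem isCuntzKriegerFamily_prefixOp : IsCuntzKriegerFamily x.prefixOp := by
  intro _ _ h
  cases h with
  | partial_isometry l =>
    rw [mul_assoc, star_prefixOp_mul_self, prefixOp_mul_prefixOp, Category.id_comp]
  | vertex_star w => rw [← star_prefixOp_mul_self (𝟙 w), star_mul, star_star]
  | vertex_idem w => rw [prefixOp_mul_prefixOp, Category.comp_id]
  | vertex_orth h => exact prefixOp_id_mul_prefixOp_id_of_ne h
  | mul ν μ => exact prefixOp_mul_prefixOp ν μ
  | star_mul l => exact star_prefixOp_mul_self l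
  | sum w n => exact prefixOp_id_eq_sum w n

end CuntzKrieger

/-! ### Gauge invariance -/

open UnitAddTorus

theorem orthonormal_mFourier_smul_germVec (z : UnitAddTorus (Fin k)) :
    Orthonormal ℂ fun g : Σ w, x.Germ w => mFourier g.2.deg z • x.germVec g.2 :=
  orthonormal_smul_of_norm_eq_one orthonormal_germVec fun g =>
    norm_mFourier_apply g.2.deg z

variable (x) in
/-- The operator on `H_x` that multiplies the basis vector of a germ `g` by `z ^ deg g`. It
implements the gauge action at `z`. -/
noncomputable def gaugeOp (z : UnitAddTorus (Fin k)) : x.H →L[ℂ] x.H :=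
  orthonormalTransfer orthonormal_germVec (orthonormal_mFourier_smul_germVec z)

theorem gaugeOp_germVec (z : UnitAddTorus (Fin k)) (g : x.Germ w) :
    x.gaugeOp z (x.germVec g) = mFourier g.deg z • x.germVec g :=
  orthonormalTransfer_apply_self orthonormal_germVec (orthonormal_mFourier_smul_germVec z) ⟨w, g⟩

theorem star_gaugeOp_smul_germVec (z : UnitAddTorus (Fin k)) (g : x.Germ w) :
    star (x.gaugeOp z) (mFourier g.deg z • x.germVec g) = x.germVec g := by
  rw [ContinuousLinearMap.star_eq_adjoint, gaugeOp, adjoint_orthonormalTransfer]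
  exact orthonormalTransfer_apply_self (orthonormal_mFourier_smul_germVec z) orthonormal_germVec
    ⟨w, g⟩

theorem gaugeOp_mem_unitary (z : UnitAddTorus (Fin k)) : x.gaugeOp z ∈ unitary (x.H →L[ℂ] x.H) := by
  refine Unitary.mem_iff.2 ⟨clm_ext_germVec fun w g => ?_, clm_ext_germVec fun w g => ?_⟩
  · rw [mul_apply_eq_comp, gaugeOp_germVec, star_gaugeOp_smul_germVec, one_apply_eq_self]
  · have scalar_ne_zero : mFourier g.deg z ≠ 0 :=
      norm_ne_zero_iff.1 ((norm_mFourier_apply g.deg z).trans_ne one_ne_zero)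
    refine smul_right_injective x.H scalar_ne_zero ?_
    dsimp only
    rw [← map_smul, mul_apply_eq_comp, star_gaugeOp_smul_germVec, gaugeOp_germVec,
      one_apply_eq_self]

theorem gaugeOp_mul_prefixOp (z : UnitAddTorus (Fin k)) (l : a ⟶ b) :
    x.gaugeOp z * x.prefixOp l = degChar l z • (x.prefixOp l * x.gaugeOp z) := by
  refine clm_ext_germVec fun w g => ?_
  rw [smul_apply, mul_apply_eq_comp, mul_apply_eq_comp, gaugeOp_germVec, map_smul]
  obtain rfl | hw := eq_or_ne w a
  · rw [prefixOp_germVec, gaugeOp_germVec, Germ.deg_comp, mFourier_add, smul_smul,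
      degChar]
  · rw [prefixOp_germVec_of_ne l hw, map_zero, smul_zero, smul_zero]

theorem gaugeOp_mul_prefixOp_mul_star (z : UnitAddTorus (Fin k)) (l : a ⟶ b) :
    x.gaugeOp z * x.prefixOp l * star (x.gaugeOp z) = degChar l z • x.prefixOp l := by
  rw [gaugeOp_mul_prefixOp, smul_mul_assoc, mul_assoc,
    Unitary.mul_star_self_of_mem (gaugeOp_mem_unitary z), mul_one]

variable [RowFinite Λ] {π : CStar Λ →⋆ₙₐ[ℂ] (x.H →L[ℂ] x.H)}

theorem map_gauge_of_map_univ (hπ : ∀ ⦃a b : Λ⦄ (l : a ⟶ b), π (univ l) = x.prefixOp l)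
    (z : UnitAddTorus (Fin k)) (y : CStar Λ) :
    π (gauge z y) = x.gaugeOp z * π y * star (x.gaugeOp z) := by
  let conjGaugeOp : (x.H →L[ℂ] x.H) →⋆ₙₐ[ℂ] (x.H →L[ℂ] x.H) := (Unitary.conjStarAlgAut ℂ _
    ⟨x.gaugeOp z, gaugeOp_mem_unitary z⟩).toNonUnitalStarAlgHom
  have comp_gauge_eq : π.comp (gauge z) = conjGaugeOp.comp π :=
    (existsUnique_lift _ (x.isCuntzKriegerFamily_prefixOp.degChar_smul z)).unique
      (fun a b l => by
        rw [NonUnitalStarAlgHom.comp_apply, gauge_univ, map_smul, hπ])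
      (fun a b l => (congrArg conjGaugeOp (hπ l)).trans (gaugeOp_mul_prefixOp_mul_star z l))
  exact DFunLike.congr_fun comp_gauge_eq y

theorem injective_of_map_univ (hπ : ∀ ⦃a b : Λ⦄ (l : a ⟶ b), π (univ l) = x.prefixOp l)
    (hx : ∀ w : Λ, ∃ i, Nonempty (x.vertex i ⟶ w)) : Function.Injective π := by
  refine injective_of_gauge_mem_ker π (fun w => ?_) fun z y hy => ?_
  · obtain ⟨i, ⟨μ⟩⟩ := hx w
    exact hπ (𝟙 w) ▸ prefixOp_id_ne_zero μ
  · rw [map_gauge_of_map_univ hπ, hy, mul_zero, zero_mul]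

end InfinitePath
end KGraph

theorem mainTheorem3_general {k : ℕ} (Λ : Type u) [Category.{v} Λ] [KGraph k Λ]
    [KGraph.RowFinite Λ] (x : KGraph.InfinitePath Λ)
    (hx : ∀ w : Λ, ∃ i, Nonempty (x.vertex i ⟶ w)) :
    TopologicalSpace.SeparableSpace x.H ∧
    ∃ T : ∀ ⦃a b : Λ⦄, (a ⟶ b) → (x.H →L[ℂ] x.H),
      x.IsPrefixing T ∧ (∀ T', x.IsPrefixing T' → T' = T) ∧
      KGraph.IsCuntzKriegerFamily T ∧
      ∃ π : KGraph.CStar Λ →⋆ₙₐ[ℂ] (x.H →L[ℂ] x.H),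
        (∀ ⦃a b : Λ⦄ (l : a ⟶ b), π (KGraph.univ l) = T l) ∧
        (∀ π' : KGraph.CStar Λ →⋆ₙₐ[ℂ] (x.H →L[ℂ] x.H),
          (∀ ⦃a b : Λ⦄ (l : a ⟶ b), π' (KGraph.univ l) = T l) → π' = π) ∧
        Function.Injective π := by
  obtain ⟨π, hπ, π_unique⟩ := KGraph.existsUnique_lift _ x.isCuntzKriegerFamily_prefixOp
  exact ⟨x.separableSpace_H, x.prefixOp, x.isPrefixing_prefixOp,
    fun _ hT => hT.eq_prefixOp, x.isCuntzKriegerFamily_prefixOp, π, hπ, π_unique,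
    KGraph.InfinitePath.injective_of_map_univ hπ hx⟩

theorem mainTheorem3 {k : ℕ} (Λ : Type u) [Category.{v} Λ] [KGraph k Λ] [KGraph.RowFinite Λ]
    (hΛ : KGraph.StronglyConnected Λ) (x : KGraph.InfinitePath Λ) :
    TopologicalSpace.SeparableSpace x.H ∧
    ∃ T : ∀ ⦃a b : Λ⦄, (a ⟶ b) → (x.H →L[ℂ] x.H),
      x.IsPrefixing T ∧ (∀ T', x.IsPrefixing T' → T' = T) ∧
      KGraph.IsCuntzKriegerFamily T ∧
      ∃ π : KGraph.CStar Λ →⋆ₙₐ[ℂ] (x.H →L[ℂ] x.H),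
        (∀ ⦃a b : Λ⦄ (l : a ⟶ b), π (KGraph.univ l) = T l) ∧
        (∀ π' : KGraph.CStar Λ →⋆ₙₐ[ℂ] (x.H →L[ℂ] x.H),
          (∀ ⦃a b : Λ⦄ (l : a ⟶ b), π' (KGraph.univ l) = T l) → π' = π) ∧
        Function.Injective π :=
  mainTheorem3_general Λ x fun w => ⟨0, hΛ w _⟩
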